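/- \textbf{Model.} Let $n, M, K_a, L$ be nonnegative integers with $M \ge 2$, $K_a \le M$, and put $J = \log_2 M$. There are $K_a$ active users ($K_a$ fixed and known) and a receiver with $L$ antennas. All users share one codebook $\mathbf X = [\mathbf x_1,\dots,\mathbf x_M] \in \mathbb C^{n\times M}$; user $k$ sends $\mathbf x_{W_k}$, where $W_1,\dots,W_{K_a}$ are i.i.d. uniform on $[M]$. Antenna $l$ receives $\mathbf y_l = \sum_{k=1}^{K_a} h_{k,l}\mathbf x_{W_k} + \mathbf z_l$, with i.i.d. fading coefficients $h_{k,l}\sim\mathcal{CN}(0,1)$ (unknown to users and receiver) and i.i.d. noise $\mathbf z_l \sim \mathcal{CN}(\mathbf 0,\mathbf I_n)$. The codebook and the decoder may depend on common randomness $\mathsf U$ known to the users and the receiver; messages, fading, noise and $\mathsf U$ are independent. From $\mathsf U$ and $\mathbf Y = [\mathbf y_1,\dots,\mathbf y_L]$ the decoder outputs a set $\hat{\mathcal W}\subset[M]$ of exactly $K_a$ messages. With $\mathcal W = \{W_1,\dots,W_{K_a}\}$ the set of distinct transmitted messages, the joint error probability is $P_{e,J} = \mathbb P[\mathcal W \ne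 \hat{\mathcal W}]$, averaged also over $\mathsf U$. For each $P > 0$ fix a probability law $\nu_P$ on $\mathbb C$ with mean $0$ and variance $P$. Let $E^*_{b,J}(n,M,\epsilon_J)$ be the infimum of the energy-per-bit $nP/J$ over all $P>0$ for which there is a code whose codebook $\mathbf X$ has i.i.d. entries of law $\nu_P$ and whose joint error probability is at most $\epsilon_J$ (the infimum of the empty set is $+\infty$). \textbf{Theorem.} Suppose $$0 \le \epsilon_J \le \frac{\binom{M}{K_a}}{1+\binom{M}{K_a}}\cdot\frac{M!}{M^{K_a}(M-K_a)!},$$ and put $\epsilon' = \epsilon_J M^{K_a}(M-K_a)!/M!$. Consider the inequality $$(1-\epsilon')\log_2\binom{M}{K_a} - h_2(\epsilon') \;\le\; nL\log_2(1+K_aP) - L\,\mathbb E\!\left[\log_2\left|\mathbf I_n + \mathbf X_{K_a}\mathbf X_{K_a}^H\right|\right], \qquad (*)$$ where $h_2(p) = -p\log_2 p-(1-p)\log_2(1-p)$ and $\mathbf X_{K_a}\in\mathbb C^{n\times K_a}$ has i.i.d. entries of law $\nu_P$. Then: \begin{enumerate} \item If $P>0$ and some code whose codebook has i.i.d. entries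 of law $\nu_P$ has joint error probability at most $\epsilon_J$, then the expectation in $(*)$ is finite and $(*)$ holds. \item Consequently $$E^*_{b,J}(n,M,\epsilon_J) \;\ge\; \inf\left\{\frac{nP}{J} : P>0 \text{ and } (*) \text{ holds}\right\}.$$ The same lower bound holds if only those codes are admitted that in addition satisfy the maximal power constraint $\|\mathbf x_m\|_2^2\le nP$ for all $m\in[M]$ almost surely. \end{enumerate} -/

import Mathlib

open MeasureTheory ProbabilityTheory

noncomputable section

namespace URA

/-- Complex `a × b` arrays (codebooks, fading coefficients, noise, received signals), with the
product σ-algebra. -/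
abbrev CArr (a b : ℕ) : Type := Fin a → Fin b → ℂ

/-- The circularly symmetric complex Gaussian law `CN(0, 1)`: independent real and imaginary
parts, each `N(0, 1/2)`. -/
def stdComplexGaussian : Measure ℂ :=
  ((gaussianReal 0 (1 / 2)).prod (gaussianReal 0 (1 / 2))).map
    Complex.measurableEquivRealProd.symm

/-- The law of an `a × b` array with i.i.d. entries of law `ν`. -/
def iidArr (a b : ℕ) (ν : Measure ℂ) : Measure (CArr a b) :=
  Measure.pi fun _ => Measure.pi fun _ => ν

/-- `ν` is a probability law on `ℂ` with mean `0` and variance `P`. -/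
structure IsEntryLaw (ν : Measure ℂ) (P : ℝ) : Prop where
  prob : IsProbabilityMeasure ν
  sq_integrable : MemLp (fun x : ℂ => x) 2 ν
  mean : ∫ x, x ∂ν = 0
  variance : ∫ x, ‖x‖ ^ 2 ∂ν = P

/-- The law of the messages `(W_k)` of the `Ka` active users: i.i.d. uniform on the message set. -/
def messageLaw (M Ka : ℕ) : Measure (Fin Ka → Fin M) :=
  Measure.pi fun _ => uniformOn Set.univ

/-- The received signal `y_{i,l} = ∑ₖ h_{k,l} x_{i,W_k} + z_{i,l}`. -/
def received {n M Ka L : ℕ} (X : CArr n M) (w : Fin Ka → Fin M) (H : CArr Ka L) (Z : CArr n L) :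
    CArr n L :=
  fun i l => ∑ k, H k l * X i (w k) + Z i l

/-- A random code for unsourced random access with `n` channel uses, `M` messages,
`Ka` active users and `L` receive antennas: common randomness `u` of law `law`, revealed to the
users and to the receiver, determines the common codebook (column `m` is the codeword of message
`m`) and the decoder, which outputs a set of exactly `Ka` messages. -/
structure EnsembleCode (n M Ka L : ℕ) where
  U : Type
  [mU : MeasurableSpace U]
  law : Measure U
  [isProb : IsProbabilityMeasure law]
  codebook : U → CArr n M
  measurable_codebook : Measurable codebook
  decode : U → CArr n L → Finset (Fin M)
  measurable_decode : Measurable fun p : U × CArr n L => decode p.1 p.2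
  card_decode : ∀ u y, (decode u y).card = Ka

attribute [instance] EnsembleCode.mU EnsembleCode.isProb

namespace EnsembleCode

variable {n M Ka L : ℕ}

/-- The entries of the codebook are i.i.d. with law `ν`. -/
def HasIIDEntries (C : EnsembleCode n M Ka L) (ν : Measure ℂ) : Prop :=
  C.law.map C.codebook = iidArr n M ν

/-- Every codeword satisfies (almost surely) the maximal power constraint `‖x_m‖² ≤ n P`. -/
def MaxPower (C : EnsembleCode n M Ka L) (P : ℝ) : Prop :=
  ∀ᵐ u ∂C.law, ∀ m, ∑ i, ‖C.codebook u i m‖ ^ 2 ≤ n * P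

/-- The joint law of common randomness, messages, fading coefficients and noise: the four are
independent, the messages are i.i.d. uniform, fading and noise have i.i.d. `CN(0, 1)` entries. -/
def jointLaw (C : EnsembleCode n M Ka L) :
    Measure (C.U × (Fin Ka → Fin M) × CArr Ka L × CArr n L) :=
  C.law.prod ((messageLaw M Ka).prod
    ((iidArr Ka L stdComplexGaussian).prod (iidArr n L stdComplexGaussian)))

/-- The joint error probability: the probability that the set of distinct transmitted messages
differs from the set of decoded messages. -/
def jointError (C : EnsembleCode n M Ka L) : ℝ :=
  C.jointLaw.real {ω | Finset.univ.image ω.2.1 ≠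
    C.decode ω.1 (received (C.codebook ω.1) ω.2.1 ω.2.2.1 ω.2.2.2)}

end EnsembleCode

/-- The binary entropy function (`Real.logb 2 0 = 0` gives the convention `0 log₂ 0 = 0`). -/
def h₂ (p : ℝ) : ℝ := -p * Real.logb 2 p - (1 - p) * Real.logb 2 (1 - p)

/-- `log₂ |I + X Xᴴ|`; the determinant is real and positive. -/
def logDet {n k : ℕ} (X : CArr n k) : ℝ :=
  Real.logb 2 (1 + Matrix.of X * (Matrix.of X).conjTranspose).det.re

/-- `M! / (M^Ka (M - Ka)!)`, for `Ka ≤ M`. -/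
def distinctRatio (M Ka : ℕ) : ℝ :=
  (M.factorial : ℝ) / ((M : ℝ) ^ Ka * ((M - Ka).factorial : ℝ))

/-- The enlarged error level `ε' = ε M^Ka (M - Ka)! / M!`, for `Ka ≤ M`. -/
def enlargedError (M Ka : ℕ) (ε : ℝ) : ℝ :=
  ε * (M : ℝ) ^ Ka * ((M - Ka).factorial : ℝ) / (M.factorial : ℝ)

/-- The Fano-type inequality at power `P`, with entry law `ν`. -/
def FanoCondition (n M Ka L : ℕ) (ε P : ℝ) (ν : Measure ℂ) : Prop :=
  (1 - enlargedError M Ka ε) * Real.logb 2 (M.choose Ka : ℝ) - h₂ (enlargedError M Ka ε) ≤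
    n * L * Real.logb 2 (1 + Ka * P) - L * ∫ X, logDet X ∂(iidArr n Ka ν)

/-- The energy-per-bit `n P / J`, with `J = log₂ M`. -/
def energyPerBit (n M : ℕ) (P : ℝ) : ℝ := n * P / Real.logb 2 M

/-- The minimum energy-per-bit over the codes whose codebook has, at power `P`, i.i.d. entries of
law `ν P`, and whose joint error probability is at most `ε` (`⊤` if there is none). -/
def minEnergyPerBit (n M Ka L : ℕ) (ε : ℝ) (ν : ℝ → Measure ℂ) : EReal :=
  sInf {e | ∃ P : ℝ, 0 < P ∧ e = (energyPerBit n M P : EReal) ∧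
    ∃ C : EnsembleCode n M Ka L, C.HasIIDEntries (ν P) ∧ C.jointError ≤ ε}

/-- The same minimum, over those codes that also satisfy the maximal power constraint. -/
def minEnergyPerBitMaxPower (n M Ka L : ℕ) (ε : ℝ) (ν : ℝ → Measure ℂ) : EReal :=
  sInf {e | ∃ P : ℝ, 0 < P ∧ e = (energyPerBit n M P : EReal) ∧
    ∃ C : EnsembleCode n M Ka L,
      C.MaxPower P ∧ C.HasIIDEntries (ν P) ∧ C.jointError ≤ ε}

/-- The infimum of `n P / J` over all `P > 0` that satisfy the Fano-type inequality. -/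
def converseBound (n M Ka L : ℕ) (ε : ℝ) (ν : ℝ → Measure ℂ) : EReal :=
  sInf {e | ∃ P : ℝ, 0 < P ∧ e = (energyPerBit n M P : EReal) ∧
    FanoCondition n M Ka L ε P (ν P)}

end URA

end

open scoped ENNReal ComplexOrder

noncomputable section

namespace URA

/-! A Fano argument in change-of-measure form, without mutual information. Fix the codebook and a
tuple `w` of distinct messages, with selected columns `X`. The output `X H + Z` is Gaussian with
density `p_w`: its `L` columns are independent with covariance `1 + X Xᴴ` (`lintegral_channelLaw`).
Compare it with the density `q` of i.i.d. `CN(0, s)` entries, which does not depend on `w`. For any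
positive bounded `φ`, `log t ≤ t - 1` applied to `t = φ q / p_w` gives `E_p[log φ] ≤ D(p_w ‖ q) +
E_q[φ] - 1` (`log_mul_add_log_mul_le`).

Take `φ_w = (1 - e) * M.choose Ka` where the decoder outputs the set of `w`, and `φ_w = e`
elsewhere. At most `Ka!` distinct tuples share the decoded set, so the `φ_w` sum to at most the
number of tuples at every output, and the terms `E_q[φ_w] - 1` contribute nothing positive in total
(`sum_log_condError_le`). The left sides produce `(1 - e) log (M.choose Ka)` minus the binary
entropy of `e`.

Averaging over the codebook, distinct messages select i.i.d. columns. With `s = 1 + Ka * P` the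
energy term of the divergence cancels exactly, leaving `L (n log s - E log det)`
(`integral_outDivergence`). Restricting the error probability to distinct tuples costs the factor
that turns `ε` into `ε'` (`sum_embedding_condError_le`). The bound on energy per bit is then
monotonicity of the infimum. -/

/-! ### Gaussian densities on arrays -/

/-- Tonelli's theorem for a product of functions of the separate coordinates. -/
theorem lintegral_pi_prod {n : ℕ} {E : Type*} [MeasurableSpace E]
    (μ : Measure E) [SigmaFinite μ] {f : Fin n → E → ℝ≥0∞} (hf : ∀ i, Measurable (f i)) :
    ∫⁻ x, ∏ i, f i (x i) ∂(Measure.pi fun _ => μ) = ∏ i, ∫⁻ x, f i x ∂μ := by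
  induction n with
  | zero => simp
  | succ n ih =>
    have h := ((measurePreserving_piFinSuccAbove (fun _ : Fin (n + 1) => μ) 0).symm).lintegral_comp_emb
      (MeasurableEquiv.measurableEmbedding _) (fun x => ∏ i, f i (x i))
    have e : ∀ p : E × (Fin n → E), ∏ i, f i
        ((MeasurableEquiv.piFinSuccAbove (fun _ : Fin (n + 1) => E) 0).symm p i) =
        f 0 p.1 * ∏ i : Fin n, f i.succ (p.2 i) := by
      intro p
      rw [Fin.prod_univ_succ]
      rfl
    rw [← h, lintegral_congr e, Fin.prod_univ_succ, ← ih fun i => hf i.succ]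
    exact lintegral_prod_mul (hf 0).aemeasurable
      (Finset.measurable_prod _ fun i _ => (hf _).comp (measurable_pi_apply i)).aemeasurable

/-- It suffices to compare both measures on boxes, where the indicator of the box factors over the
coordinates. -/
theorem pi_withDensity {n : ℕ} {E : Type*} [MeasurableSpace E]
    (μ : Measure E) [SigmaFinite μ] {f : E → ℝ≥0∞}
    (hf : Measurable f) [SigmaFinite (μ.withDensity f)] :
    Measure.pi (fun _ : Fin n => μ.withDensity f) =
      (Measure.pi fun _ => μ).withDensity fun x => ∏ i, f (x i) := by
  refine Measure.pi_eq fun s hs => ?_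
  rw [withDensity_apply _ (MeasurableSet.univ_pi hs), ← lintegral_indicator (.univ_pi hs)]
  simp_rw [withDensity_apply _ (hs _), ← lintegral_indicator (hs _)]
  rw [← lintegral_pi_prod μ fun i => hf.indicator (hs i)]
  refine lintegral_congr fun x => ?_
  by_cases hx : x ∈ Set.univ.pi s
  · rw [Set.indicator_of_mem hx]
    exact Finset.prod_congr rfl fun i _ => (Set.indicator_of_mem (hx i trivial) _).symm
  · rw [Set.indicator_of_notMem hx]
    obtain ⟨i, hi⟩ : ∃ i, x i ∉ s i := by simpa [Set.mem_pi] using hx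
    exact (Finset.prod_eq_zero (Finset.mem_univ i) (Set.indicator_of_notMem hi _)).symm

instance : IsProbabilityMeasure stdComplexGaussian :=
  Measure.isProbabilityMeasure_map (MeasurableEquiv.measurable _).aemeasurable

instance (a b : ℕ) (ν : Measure ℂ) [IsProbabilityMeasure ν] :
    IsProbabilityMeasure (iidArr a b ν) := by
  unfold iidArr; infer_instance

theorem stdComplexGaussian_eq_withDensity :
    stdComplexGaussian =
      volume.withDensity fun z : ℂ => ENNReal.ofReal (Real.pi⁻¹ * Real.exp (-‖z‖ ^ 2)) := by
  have h2 : (1 / 2 : NNReal) ≠ 0 := by norm_num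
  have hm := (Complex.volume_preserving_equiv_real_prod.symm)
  ext s hs
  rw [stdComplexGaussian, Measure.map_apply (MeasurableEquiv.measurable _) hs,
    gaussianReal_of_var_ne_zero _ h2,
    prod_withDensity (measurable_gaussianPDF _ _) (measurable_gaussianPDF _ _),
    withDensity_apply _ hs, withDensity_apply _ (MeasurableEquiv.measurable _ hs),
    ← hm.setLIntegral_comp_preimage hs (by fun_prop), ← Measure.volume_eq_prod]
  refine lintegral_congr fun p => ?_
  rw [gaussianPDF, gaussianPDF, ← ENNReal.ofReal_mul (gaussianPDFReal_nonneg _ _ _)]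
  congr 1
  have hs : ‖Complex.measurableEquivRealProd.symm p‖ ^ 2 = p.1 ^ 2 + p.2 ^ 2 := by
    rw [← Complex.normSq_eq_norm_sq, Complex.measurableEquivRealProd_symm_apply,
      Complex.normSq_mk]; ring
  have hpi : √(2 * Real.pi * ((1 / 2 : NNReal) : ℝ)) * √(2 * Real.pi * ((1 / 2 : NNReal) : ℝ)) =
      Real.pi := by
    rw [Real.mul_self_sqrt (by positivity)]; push_cast; ring
  rw [hs, gaussianPDFReal, gaussianPDFReal, mul_mul_mul_comm, ← Real.exp_add, ← mul_inv, hpi]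
  congr 2
  push_cast
  ring

/-- The squared Frobenius norm. -/
def energy {a b : ℕ} (Y : CArr a b) : ℝ := ∑ i, ∑ j, ‖Y i j‖ ^ 2

@[fun_prop]
theorem measurable_energy {a b : ℕ} : Measurable (energy : CArr a b → ℝ) := by
  unfold energy; fun_prop

theorem iidArr_stdComplexGaussian (a b : ℕ) :
    iidArr a b stdComplexGaussian = volume.withDensity fun Y : CArr a b =>
      ENNReal.ofReal (Real.pi⁻¹ ^ (a * b) * Real.exp (-energy Y)) := by
  have key : ∀ (n : ℕ) (f : Fin n → ℝ), (∀ i, 0 ≤ f i) → ∏ i, ENNReal.ofReal (f i) =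
      ENNReal.ofReal (∏ i, f i) := fun n f hf =>
    (ENNReal.ofReal_prod_of_nonneg fun i _ => hf i).symm
  set g : ℂ → ℝ≥0∞ := fun z => ENNReal.ofReal (Real.pi⁻¹ * Real.exp (-‖z‖ ^ 2)) with hg
  have hgm : Measurable g := by fun_prop
  have e0 := stdComplexGaussian_eq_withDensity
  rw [← hg] at e0
  have i0 : IsProbabilityMeasure ((volume : Measure ℂ).withDensity g) := by
    rw [← e0]; infer_instance
  have e1 : Measure.pi (fun _ : Fin b => stdComplexGaussian) =
      (volume : Measure (Fin b → ℂ)).withDensity fun y => ∏ j, g (y j) := by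
    rw [e0, pi_withDensity volume hgm]; rfl
  have i1 : IsProbabilityMeasure
      ((volume : Measure (Fin b → ℂ)).withDensity fun y => ∏ j, g (y j)) := by
    rw [← e1]; infer_instance
  have hgm1 : Measurable fun y : Fin b → ℂ => ∏ j, g (y j) := by fun_prop
  rw [iidArr, e1, pi_withDensity volume hgm1]
  refine congrArg _ (funext fun Y => ?_)
  simp only [hg]
  simp_rw [key b _ fun i => mul_nonneg (inv_nonneg.2 Real.pi_pos.le) (Real.exp_nonneg _)]
  rw [key a _ fun i => Finset.prod_nonneg fun i _ =>
    mul_nonneg (inv_nonneg.2 Real.pi_pos.le) (Real.exp_nonneg _)]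
  simp only [Finset.prod_mul_distrib, ← Real.exp_sum, Finset.prod_const, Finset.card_univ,
    Fintype.card_fin, energy, Finset.sum_neg_distrib, ← pow_mul, mul_comm b a]

/-- The Gaussian integral is read off from the total mass 1 of the law whose density was just found.
-/
theorem lintegral_exp_neg_energy (a b : ℕ) :
    ∫⁻ Y : CArr a b, ENNReal.ofReal (Real.exp (-energy Y)) =
      ENNReal.ofReal (Real.pi ^ (a * b)) := by
  have h1 : iidArr a b stdComplexGaussian Set.univ = 1 := measure_univ
  rw [iidArr_stdComplexGaussian, withDensity_apply _ .univ, Measure.restrict_univ] at h1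
  simp_rw [ENNReal.ofReal_mul (pow_nonneg (inv_nonneg.2 Real.pi_pos.le) (a * b))] at h1
  rw [lintegral_const_mul _ (by fun_prop), inv_pow, ENNReal.ofReal_inv_of_pos (by positivity)] at h1
  have h0 : ENNReal.ofReal (Real.pi ^ (a * b)) ≠ 0 := by
    simpa using pow_pos Real.pi_pos (a * b)
  rw [← mul_one (ENNReal.ofReal (Real.pi ^ (a * b))), ← h1, ← mul_assoc,
    ENNReal.mul_inv_cancel h0 ENNReal.ofReal_ne_top, one_mul]

/-! ### Linear changes of variables on arrays -/

instance isAddHaarMeasure_volume_arr (a b : ℕ) :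
    (volume : Measure (CArr a b)).IsAddHaarMeasure :=
  have : (volume : Measure (Fin b → ℂ)).IsAddHaarMeasure := inferInstance
  Measure.pi.isAddHaarMeasure (μ := fun _ : Fin a => (volume : Measure (Fin b → ℂ)))

/-- Left multiplication of an array by a matrix. -/
def mulArr {a b c : ℕ} (A : Matrix (Fin a) (Fin b) ℂ) (H : CArr b c) : CArr a c :=
  fun i l => ∑ j, A i j * H j l

theorem of_mulArr {a b c : ℕ} (A : Matrix (Fin a) (Fin b) ℂ) (H : CArr b c) :
    Matrix.of (mulArr A H) = A * Matrix.of H := by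
  ext; simp [mulArr, Matrix.mul_apply]

@[fun_prop]
theorem measurable_mulArr {a b c : ℕ} (A : Matrix (Fin a) (Fin b) ℂ) :
    Measurable (mulArr A : CArr b c → CArr a c) := by
  unfold mulArr; fun_prop

/-- Left multiplication by a square matrix, as a complex linear map. -/
def mulArrLin {k : ℕ} (L : ℕ) (A : Matrix (Fin k) (Fin k) ℂ) : CArr k L →ₗ[ℂ] CArr k L where
  toFun := mulArr A
  map_add' H K := by ext; simp [mulArr, mul_add, Finset.sum_add_distrib]
  map_smul' c H := by
    ext; simp only [mulArr, Pi.smul_apply, smul_eq_mul, RingHom.id_apply, Finset.mul_sum]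
    exact Finset.sum_congr rfl fun _ _ => by ring

/-- The matrix acts separately on each of the `L` columns, so after transposition the map is a
product of `L` copies of it. -/
theorem det_mulArrLin {k L : ℕ} (A : Matrix (Fin k) (Fin k) ℂ) :
    LinearMap.det (mulArrLin L A) = A.det ^ L := by
  let e : CArr k L ≃ₗ[ℂ] (Fin L → Fin k → ℂ) :=
    { toFun := fun H l i => H i l
      invFun := fun H i l => H l i
      map_add' := fun _ _ => rfl
      map_smul' := fun _ _ => rfl
      left_inv := fun _ => rfl
      right_inv := fun _ => rfl }
  rw [← LinearMap.det_conj (mulArrLin L A) e]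
  have : (e : CArr k L →ₗ[ℂ] _) ∘ₗ mulArrLin L A ∘ₗ (e.symm : (Fin L → Fin k → ℂ) →ₗ[ℂ] CArr k L) =
      LinearMap.pi (fun l : Fin L => (Matrix.toLin' A).comp (LinearMap.proj l)) := by
    ext; rfl
  rw [this, LinearMap.det_pi]
  simp

theorem lintegral_comp_mulArr {k L : ℕ} (A : Matrix (Fin k) (Fin k) ℂ) (hA : A.det ≠ 0)
    {F : CArr k L → ℝ≥0∞} (hF : Measurable F) :
    ∫⁻ H, F (mulArr A H) = ENNReal.ofReal ((‖A.det‖ ^ 2) ^ L)⁻¹ * ∫⁻ H, F H := by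
  -- Lebesgue measure sees the real determinant, which for a complex-linear map is the squared
  -- modulus of the complex one.
  have hdet : LinearMap.det ((mulArrLin L A).restrictScalars ℝ) = (‖A.det‖ ^ 2) ^ L := by
    rw [LinearMap.det_restrictScalars, det_mulArrLin, Algebra.norm_complex_apply, map_pow,
      Complex.normSq_eq_norm_sq]
  have h0 : LinearMap.det ((mulArrLin L A).restrictScalars ℝ) ≠ 0 := by
    rw [hdet]; simpa using fun h => absurd h hA
  have := Measure.map_linearMap_addHaar_eq_smul_addHaar (volume : Measure (CArr k L)) h0
  have hm : Measurable ((mulArrLin L A).restrictScalars ℝ) := measurable_mulArr A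
  change ∫⁻ H, F ((mulArrLin L A).restrictScalars ℝ H) = _
  rw [← lintegral_map (f := F) hF hm, this, lintegral_smul_measure, hdet,
    abs_of_nonneg (by positivity)]
  rfl

/-! ### Hermitian forms, the Gram matrix and completing the square -/

open Matrix in
/-- The Hermitian form `re tr (Yᴴ W Y)`. -/
def hermForm {n L : ℕ} (W : Matrix (Fin n) (Fin n) ℂ) (Y : CArr n L) : ℝ :=
  ((of Y)ᴴ * W * of Y).trace.re

open Matrix in
theorem energy_eq_trace {a b : ℕ} (Y : CArr a b) : energy Y = ((of Y)ᴴ * of Y).trace.re := by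
  rw [Matrix.trace, Complex.re_sum, energy, Finset.sum_comm]
  refine Finset.sum_congr rfl fun j _ => ?_
  rw [diag_apply, mul_apply, Complex.re_sum]
  refine Finset.sum_congr rfl fun i _ => ?_
  rw [conjTranspose_apply, of_apply, ← Complex.normSq_eq_norm_sq, Complex.star_def,
    ← Complex.normSq_eq_conj_mul_self, Complex.ofReal_re]

theorem hermForm_one {n L : ℕ} (Y : CArr n L) : hermForm 1 Y = energy Y := by
  rw [hermForm, Matrix.mul_one, energy_eq_trace]

@[fun_prop]
theorem continuous_hermForm {n L : ℕ} (W : Matrix (Fin n) (Fin n) ℂ) :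
    Continuous (hermForm W : CArr n L → ℝ) := by
  have h : ∀ Y : CArr n L, hermForm W Y =
      ∑ l, (∑ j, (∑ i, star (Y i l) * W i j) * Y j l).re := by
    intro Y
    simp [hermForm, Matrix.trace, Matrix.mul_apply]
  rw [show (hermForm W : CArr n L → ℝ) = _ from funext h]
  fun_prop

@[fun_prop]
theorem measurable_hermForm {n L : ℕ} (W : Matrix (Fin n) (Fin n) ℂ) :
    Measurable (hermForm W : CArr n L → ℝ) :=
  (continuous_hermForm W).measurable

open Matrix

/-- The Gram matrix `1 + Xᴴ X`. -/
def gram {n k : ℕ} (X : Matrix (Fin n) (Fin k) ℂ) : Matrix (Fin k) (Fin k) ℂ := 1 + Xᴴ * X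

theorem gram_posDef {n k : ℕ} (X : Matrix (Fin n) (Fin k) ℂ) : (gram X).PosDef :=
  PosDef.one.add_posSemidef (posSemidef_conjTranspose_mul_self X)

theorem isUnit_det_gram {n k : ℕ} (X : Matrix (Fin n) (Fin k) ℂ) : IsUnit (gram X).det :=
  (isUnit_iff_isUnit_det _).1 (gram_posDef X).isUnit

/-- The inverse covariance `(1 + X Xᴴ)⁻¹`, in the form given by the Woodbury identity. -/
def precision {n k : ℕ} (X : Matrix (Fin n) (Fin k) ℂ) : Matrix (Fin n) (Fin n) ℂ :=
  1 - X * (gram X)⁻¹ * Xᴴ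

theorem precision_mul {n k : ℕ} (X : Matrix (Fin n) (Fin k) ℂ) :
    precision X * (1 + X * Xᴴ) = 1 := by
  have h : (gram X)⁻¹ * (1 + Xᴴ * X) = 1 := nonsing_inv_mul _ (isUnit_det_gram X)
  have h2 : X * (gram X)⁻¹ * Xᴴ * (1 + X * Xᴴ) = X * Xᴴ := by
    calc X * (gram X)⁻¹ * Xᴴ * (1 + X * Xᴴ) = X * ((gram X)⁻¹ * (1 + Xᴴ * X)) * Xᴴ := by
          simp only [Matrix.mul_add, Matrix.add_mul, Matrix.mul_one, Matrix.mul_assoc]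
      _ = X * Xᴴ := by rw [h, Matrix.mul_one]
  rw [precision, Matrix.sub_mul, h2, Matrix.one_mul, add_sub_cancel_right]

-- Any factor `A` with `Aᴴ A` equal to the Gram matrix turns its quadratic form into `energy (mulArr
-- A H)`, so a Gaussian integral with this form reduces to the standard one by the substitution `A`.
open scoped MatrixOrder Matrix.Norms.L2Operator in
theorem exists_sqrt_gram {n k : ℕ} (X : Matrix (Fin n) (Fin k) ℂ) :
    ∃ A : Matrix (Fin k) (Fin k) ℂ, Aᴴ * A = gram X ∧ A.det ≠ 0 ∧
      ‖A.det‖ ^ 2 = (gram X).det.re := by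
  obtain ⟨A, hA⟩ : ∃ A : Matrix (Fin k) (Fin k) ℂ, gram X = Aᴴ * A := by
    have h := nonneg_iff_posSemidef.2 (gram_posDef X).posSemidef
    obtain ⟨A, hA⟩ := CStarAlgebra.nonneg_iff_eq_star_mul_self.1 h
    exact ⟨A, hA⟩
  have hd : (gram X).det = ((‖A.det‖ ^ 2 : ℝ) : ℂ) := by
    rw [hA, det_mul, det_conjTranspose, Complex.star_def, ← Complex.normSq_eq_conj_mul_self,
      Complex.normSq_eq_norm_sq]
  refine ⟨A, hA.symm, ?_, by rw [hd, Complex.ofReal_re]⟩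
  intro h0
  exact (isUnit_det_gram X).ne_zero (by rw [hd, h0]; simp)

/-- Completing the square. -/
theorem energy_add_energy_sub {n k L : ℕ} (X : Matrix (Fin n) (Fin k) ℂ)
    {A : Matrix (Fin k) (Fin k) ℂ} (hA : Aᴴ * A = gram X) (H : CArr k L) (Y : CArr n L) :
    energy H + energy (Y - mulArr X H) =
      energy (mulArr A (H - mulArr ((gram X)⁻¹ * Xᴴ) Y)) + hermForm (precision X) Y := by
  set K : Matrix (Fin k) (Fin L) ℂ := (gram X)⁻¹ * Xᴴ * of Y with hK
  have e1 : of (Y - mulArr X H) = of Y - X * of H := by rw [← of_mulArr]; rfl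
  have e2 : of (mulArr A (H - mulArr ((gram X)⁻¹ * Xᴴ) Y)) = A * (of H - K) := by
    rw [of_mulArr, hK, ← of_mulArr]; rfl
  have hB : gram X * K = Xᴴ * of Y := by
    rw [hK, ← Matrix.mul_assoc, ← Matrix.mul_assoc, mul_nonsing_inv _ (isUnit_det_gram X),
      Matrix.one_mul]
  have hB' : Kᴴ * gram X = (of Y)ᴴ * X := by
    have := congrArg conjTranspose hB
    rwa [conjTranspose_mul (gram X) K, conjTranspose_mul Xᴴ, conjTranspose_conjTranspose,
      (gram_posDef X).isHermitian.eq] at this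
  have hW : (of Y)ᴴ * precision X * of Y = (of Y)ᴴ * of Y - (of Y)ᴴ * X * K := by
    rw [precision, hK]
    simp only [Matrix.mul_sub, Matrix.sub_mul, Matrix.mul_one, Matrix.mul_assoc]
  rw [energy_eq_trace, energy_eq_trace, energy_eq_trace, hermForm, ← Complex.add_re,
    ← Complex.add_re, ← trace_add, ← trace_add, e1, e2, hW]
  congr 2
  have e3 : (A * (of H - K))ᴴ * (A * (of H - K)) =
      (of H)ᴴ * gram X * of H - (of H)ᴴ * (gram X * K) - (Kᴴ * gram X) * of H +
        (Kᴴ * gram X) * K := by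
    rw [← hA, conjTranspose_mul, conjTranspose_sub]
    simp only [Matrix.mul_sub, Matrix.sub_mul, Matrix.mul_assoc]
    abel
  rw [e3, hB, hB', gram, conjTranspose_sub, conjTranspose_mul]
  simp only [Matrix.mul_sub, Matrix.sub_mul, Matrix.mul_add, Matrix.add_mul, Matrix.mul_one,
    Matrix.mul_assoc]
  abel

/-! ### The output density of the channel -/

/-- The joint law of fading and noise. -/
def channelLaw (n k L : ℕ) : Measure (CArr k L × CArr n L) :=
  (iidArr k L stdComplexGaussian).prod (iidArr n L stdComplexGaussian)

instance (n k L : ℕ) : IsProbabilityMeasure (channelLaw n k L) := by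
  unfold channelLaw; infer_instance

/-- The density of `X H + Z`. -/
def outDensity {n k : ℕ} (L : ℕ) (X : Matrix (Fin n) (Fin k) ℂ) (Y : CArr n L) : ℝ :=
  Real.pi⁻¹ ^ (n * L) * ((gram X).det.re ^ L)⁻¹ * Real.exp (-hermForm (precision X) Y)

theorem det_gram_pos {n k : ℕ} (X : Matrix (Fin n) (Fin k) ℂ) : 0 < (gram X).det.re := by
  obtain ⟨A, -, h0, h⟩ := exists_sqrt_gram X
  rw [← h]; have := norm_pos_iff.2 h0; positivity

/-- Translate the noise by the signal, exchange the integrals, and integrate out the fading at fixed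
output `Y`. Completing the square leaves a shifted Gaussian in `H`, whose integral supplies the
power of the determinant, times the exponential of the precision form. -/
theorem lintegral_channelLaw {n k L : ℕ} (X : Matrix (Fin n) (Fin k) ℂ) {g : CArr n L → ℝ≥0∞}
    (hg : Measurable g) :
    ∫⁻ p, g (mulArr X p.1 + p.2) ∂(channelLaw n k L) =
      ∫⁻ Y, g Y * ENNReal.ofReal (outDensity L X Y) := by
  obtain ⟨A, hA, hA0, hAd⟩ := exists_sqrt_gram X
  set cH : ℝ := Real.pi⁻¹ ^ (k * L) with hcH
  set cZ : ℝ := Real.pi⁻¹ ^ (n * L) with hcZ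
  have hpi := Real.pi_pos
  have hcH0 : 0 ≤ cH := by positivity
  have hcZ0 : 0 ≤ cZ := by positivity
  have inner : ∀ H : CArr k L, ∫⁻ Z, g (mulArr X H + Z) ∂(iidArr n L stdComplexGaussian) =
      ∫⁻ Y, ENNReal.ofReal (cZ * Real.exp (-energy (Y - mulArr X H))) * g Y := by
    intro H
    rw [iidArr_stdComplexGaussian, lintegral_withDensity_eq_lintegral_mul _ (by fun_prop)
      (by fun_prop), ← lintegral_add_left_eq_self (fun Y =>
        ENNReal.ofReal (cZ * Real.exp (-energy (Y - mulArr X H))) * g Y) (mulArr X H)]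
    simp [hcZ]
  have fiber : ∀ Y : CArr n L, ∫⁻ H : CArr k L, ENNReal.ofReal (cH * Real.exp (-energy H)) *
      ENNReal.ofReal (cZ * Real.exp (-energy (Y - mulArr X H))) =
      ENNReal.ofReal (outDensity L X Y) := by
    intro Y
    have e : ∀ H : CArr k L, ENNReal.ofReal (cH * Real.exp (-energy H)) *
        ENNReal.ofReal (cZ * Real.exp (-energy (Y - mulArr X H))) =
        ENNReal.ofReal (cH * cZ * Real.exp (-hermForm (precision X) Y)) *
          ENNReal.ofReal (Real.exp (-energy (mulArr A (H - mulArr ((gram X)⁻¹ * Xᴴ) Y)))) := by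
      intro H
      rw [← ENNReal.ofReal_mul (by positivity), ← ENNReal.ofReal_mul (by positivity)]
      congr 1
      rw [mul_mul_mul_comm, ← Real.exp_add, mul_assoc (cH * cZ), ← Real.exp_add]
      congr 2
      linarith [energy_add_energy_sub X hA H Y]
    -- Translation invariance removes the centre of the Gaussian in `H`; the substitution `A` then
    -- gives the Jacobian `(‖A.det‖ ^ 2) ^ L`.
    rw [lintegral_congr e, lintegral_const_mul _ (by fun_prop),
      lintegral_sub_right_eq_self (fun H : CArr k L =>
        ENNReal.ofReal (Real.exp (-energy (mulArr A H)))),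
      lintegral_comp_mulArr A hA0 (F := fun H => ENNReal.ofReal (Real.exp (-energy H)))
        (by fun_prop), lintegral_exp_neg_energy, ← ENNReal.ofReal_mul (by positivity),
      ← ENNReal.ofReal_mul (by positivity), outDensity, hAd]
    congr 1
    have : cH * Real.pi ^ (k * L) = 1 := by
      rw [hcH, ← mul_pow, inv_mul_cancel₀ hpi.ne', one_pow]
    linear_combination (cZ * Real.exp (-hermForm (precision X) Y) * ((gram X).det.re ^ L)⁻¹) * this
  rw [channelLaw, lintegral_prod _ (by fun_prop)]
  simp_rw [inner]
  rw [iidArr_stdComplexGaussian, lintegral_withDensity_eq_lintegral_mul _ (by fun_prop)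
    (Measurable.lintegral_prod_right' (f := fun p : CArr k L × CArr n L =>
      ENNReal.ofReal (cZ * Real.exp (-energy (p.2 - mulArr X p.1))) * g p.2) (by fun_prop))]
  simp_rw [Pi.mul_apply]
  have pull : ∀ H : CArr k L, ENNReal.ofReal (Real.pi⁻¹ ^ (k * L) * Real.exp (-energy H)) *
      ∫⁻ Y, ENNReal.ofReal (cZ * Real.exp (-energy (Y - mulArr X H))) * g Y =
      ∫⁻ Y, ENNReal.ofReal (cH * Real.exp (-energy H)) *
        (ENNReal.ofReal (cZ * Real.exp (-energy (Y - mulArr X H))) * g Y) := fun H =>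
    (lintegral_const_mul _ (by fun_prop)).symm
  rw [lintegral_congr pull, lintegral_lintegral_swap (by fun_prop)]
  refine lintegral_congr fun Y => ?_
  rw [← fiber Y, ← lintegral_const_mul _ (by fun_prop)]
  exact lintegral_congr fun H => by ring

/-! ### Second moments of the channel output -/

theorem integrable_sq_gaussianReal (v : NNReal) :
    Integrable (fun x : ℝ => x ^ 2) (gaussianReal 0 v) :=
  (memLp_id_gaussianReal' 2 (by simp)).integrable_sq

theorem integral_sq_gaussianReal (v : NNReal) : ∫ x : ℝ, x ^ 2 ∂(gaussianReal 0 v) = v := by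
  have h := variance_id_gaussianReal (μ := 0) (v := v)
  rw [variance_eq_integral aemeasurable_id] at h
  simpa using h

theorem integrable_normSq_stdComplexGaussian :
    Integrable (fun z : ℂ => ‖z‖ ^ 2) stdComplexGaussian ∧
      ∫ z, ‖z‖ ^ 2 ∂stdComplexGaussian = 1 := by
  have hs : ∀ p : ℝ × ℝ, ‖Complex.measurableEquivRealProd.symm p‖ ^ 2 = p.1 ^ 2 + p.2 ^ 2 := by
    intro p
    rw [← Complex.normSq_eq_norm_sq, Complex.measurableEquivRealProd_symm_apply,
      Complex.normSq_mk]; ring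
  have i1 : Integrable (fun p : ℝ × ℝ => p.1 ^ 2)
      ((gaussianReal 0 (1 / 2)).prod (gaussianReal 0 (1 / 2))) :=
    (integrable_sq_gaussianReal _).comp_fst _
  have i2 : Integrable (fun p : ℝ × ℝ => p.2 ^ 2)
      ((gaussianReal 0 (1 / 2)).prod (gaussianReal 0 (1 / 2))) :=
    (integrable_sq_gaussianReal _).comp_snd _
  constructor
  · rw [stdComplexGaussian, integrable_map_equiv]
    exact (i1.add i2).congr (.of_forall fun p => (hs p).symm)
  · rw [stdComplexGaussian, integral_map_equiv]
    simp_rw [hs]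
    rw [integral_add i1 i2, integral_fun_fst (f := fun x : ℝ => x ^ 2),
      integral_fun_snd (f := fun x : ℝ => x ^ 2), integral_sq_gaussianReal]
    norm_num

theorem memLp_stdComplexGaussian : MemLp (fun z : ℂ => z) 2 stdComplexGaussian :=
  (memLp_two_iff_integrable_sq_norm (by fun_prop)).2 integrable_normSq_stdComplexGaussian.1

theorem integral_stdComplexGaussian : ∫ z, z ∂stdComplexGaussian = 0 := by
  have hs : ∀ p : ℝ × ℝ, Complex.measurableEquivRealProd.symm p = p.1 + p.2 * Complex.I := by
    intro p
    rw [Complex.measurableEquivRealProd_symm_apply, Complex.mk_eq_add_mul_I]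
  have i0 : Integrable (fun x : ℝ => (x : ℂ)) (gaussianReal 0 (1 / 2)) :=
    ((memLp_id_gaussianReal' 1 (by simp)).integrable le_rfl).ofReal
  rw [stdComplexGaussian, integral_map_equiv]
  simp_rw [hs]
  rw [integral_add (i0.comp_fst _) ((i0.comp_snd _).mul_const _), integral_mul_const,
    integral_fun_fst (f := fun x : ℝ => (x : ℂ)), integral_fun_snd (f := fun x : ℝ => (x : ℂ)),
    integral_complex_ofReal, integral_id_gaussianReal]
  simp

theorem memLp_arr {a b : ℕ} (i : Fin a) (l : Fin b) :
    MemLp (fun Y : CArr a b => Y i l) 2 (iidArr a b stdComplexGaussian) := by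
  have h1 := memLp_stdComplexGaussian.comp_measurePreserving
    (measurePreserving_eval (fun _ : Fin b => stdComplexGaussian) l)
  exact h1.comp_measurePreserving (measurePreserving_eval
    (fun _ : Fin a => Measure.pi fun _ : Fin b => stdComplexGaussian) i)

theorem integral_comp_arr {a b : ℕ} {ν : Measure ℂ} [IsProbabilityMeasure ν] (i : Fin a)
    (l : Fin b) {E : Type*} [NormedAddCommGroup E] [NormedSpace ℝ E] {f : ℂ → E}
    (hf : StronglyMeasurable f) :
    ∫ Y : CArr a b, f (Y i l) ∂(iidArr a b ν) = ∫ z, f z ∂ν := by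
  rw [iidArr, integral_comp_eval (f := fun y : Fin b → ℂ => f (y l))
    (μ := fun _ : Fin a => Measure.pi fun _ : Fin b => ν)
    (hf.comp_measurable (measurable_pi_apply l)).aestronglyMeasurable,
    integral_comp_eval (μ := fun _ : Fin b => ν) hf.aestronglyMeasurable]

theorem integral_arr {a b : ℕ} (i : Fin a) (l : Fin b) :
    ∫ Y : CArr a b, Y i l ∂(iidArr a b stdComplexGaussian) = 0 := by
  rw [integral_comp_arr i l (f := fun z => z) stronglyMeasurable_id, integral_stdComplexGaussian]

theorem integral_arr_mul_star {a b : ℕ} (i j : Fin a) (l : Fin b) :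
    ∫ Y : CArr a b, Y i l * star (Y j l) ∂(iidArr a b stdComplexGaussian) =
      if i = j then 1 else 0 := by
  split_ifs with h
  · subst h
    rw [integral_comp_arr i l (f := fun z => z * star z)
      (Continuous.stronglyMeasurable (by fun_prop))]
    have : ∀ z : ℂ, z * star z = ((‖z‖ ^ 2 : ℝ) : ℂ) := fun z => by
      rw [Complex.star_def, Complex.mul_conj, Complex.normSq_eq_norm_sq]
    simp_rw [this]
    rw [integral_complex_ofReal, integrable_normSq_stdComplexGaussian.2]; simp
  · have hi := iIndepFun_pi (μ := fun _ : Fin a => Measure.pi fun _ : Fin b => stdComplexGaussian)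
      (X := fun _ (y : Fin b → ℂ) => y l) (fun _ => (measurable_pi_apply l).aemeasurable)
    have h2 := (hi.indepFun h).comp (φ := fun z => z) (ψ := fun z : ℂ => star z)
      measurable_id (Continuous.measurable (by fun_prop))
    have := h2.integral_fun_mul_eq_mul_integral
      (memLp_arr i l).1 (memLp_arr j l).1.star
    refine this.trans ?_
    have h0 := integral_arr (a := a) i l
    rw [iidArr] at h0
    simp only [Function.comp_def]
    rw [h0, zero_mul]

theorem integrable_mul_star {Ω : Type*} [MeasurableSpace Ω] {μ : Measure Ω} {f g : Ω → ℂ}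
    (hf : MemLp f 2 μ) (hg : MemLp g 2 μ) : Integrable (fun ω => f ω * star (g ω)) μ :=
  hf.integrable_mul hg.star

/-- Expand the product: the mixed fading-noise terms vanish by independence and zero mean, and the
fading and noise covariances are identities. -/
theorem integral_output_mul_star {n k L : ℕ} (X : Matrix (Fin n) (Fin k) ℂ) (i j : Fin n)
    (l : Fin L) :
    Integrable (fun p => (mulArr X p.1 + p.2) i l * star ((mulArr X p.1 + p.2) j l))
      (channelLaw n k L) ∧
    ∫ p, (mulArr X p.1 + p.2) i l * star ((mulArr X p.1 + p.2) j l) ∂(channelLaw n k L) =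
      (1 + X * Xᴴ : Matrix (Fin n) (Fin n) ℂ) i j := by
  have mH : ∀ a, MemLp (fun p : CArr k L × CArr n L => p.1 a l) 2 (channelLaw n k L) :=
    fun a => (memLp_arr a l).comp_fst _
  have mZ : ∀ a, MemLp (fun p : CArr k L × CArr n L => p.2 a l) 2 (channelLaw n k L) :=
    fun a => (memLp_arr a l).comp_snd _
  have eHH : ∀ a b, ∫ p, p.1 a l * star (p.1 b l) ∂(channelLaw n k L) = if a = b then 1 else 0 := by
    intro a b
    rw [channelLaw, integral_fun_fst (f := fun H : CArr k L => H a l * star (H b l)),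
      integral_arr_mul_star]
    simp
  have eZZ : ∀ a b, ∫ p, p.2 a l * star (p.2 b l) ∂(channelLaw n k L) = if a = b then 1 else 0 := by
    intro a b
    rw [channelLaw, integral_fun_snd (f := fun H : CArr n L => H a l * star (H b l)),
      integral_arr_mul_star]
    simp
  have eHZ : ∀ a b, ∫ p, p.1 a l * star (p.2 b l) ∂(channelLaw n k L) = 0 := by
    intro a b
    rw [channelLaw, integral_prod_mul (fun H : CArr k L => H a l)
      (fun Z : CArr n L => star (Z b l)), integral_arr, zero_mul]
  have eZH : ∀ a b, ∫ p, p.2 a l * star (p.1 b l) ∂(channelLaw n k L) = 0 := by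
    intro a b
    simp_rw [mul_comm _ (star _)]
    rw [channelLaw, integral_prod_mul (fun H : CArr k L => star (H b l))
      (fun Z : CArr n L => Z a l), integral_arr, mul_zero]
  have i1 : Integrable (fun p : CArr k L × CArr n L =>
      ∑ a, ∑ b, X i a * star (X j b) * (p.1 a l * star (p.1 b l))) (channelLaw n k L) :=
    integrable_finsetSum _ fun a _ => integrable_finsetSum _ fun b _ =>
      (integrable_mul_star (mH a) (mH b)).const_mul _
  have i2 : Integrable (fun p : CArr k L × CArr n L =>
      ∑ a, X i a * (p.1 a l * star (p.2 j l))) (channelLaw n k L) :=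
    integrable_finsetSum _ fun a _ => (integrable_mul_star (mH a) (mZ j)).const_mul _
  have i3 : Integrable (fun p : CArr k L × CArr n L =>
      ∑ b, star (X j b) * (p.2 i l * star (p.1 b l))) (channelLaw n k L) :=
    integrable_finsetSum _ fun a _ => (integrable_mul_star (mZ i) (mH a)).const_mul _
  have i4 := integrable_mul_star (mZ i) (mZ j)
  have e : ∀ p : CArr k L × CArr n L,
      (mulArr X p.1 + p.2) i l * star ((mulArr X p.1 + p.2) j l) =
      ∑ a, ∑ b, X i a * star (X j b) * (p.1 a l * star (p.1 b l)) +
      ∑ a, X i a * (p.1 a l * star (p.2 j l)) + ∑ b, star (X j b) * (p.2 i l * star (p.1 b l)) +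
      p.2 i l * star (p.2 j l) := by
    intro p
    simp only [Pi.add_apply, mulArr, star_add, star_sum, star_mul', add_mul, mul_add,
      Finset.sum_mul, Finset.mul_sum]
    have s1 : ∑ a, ∑ b, X i a * p.1 a l * (star (X j b) * star (p.1 b l)) =
        ∑ a, ∑ b, X i a * star (X j b) * (p.1 a l * star (p.1 b l)) :=
      Finset.sum_congr rfl fun a _ => Finset.sum_congr rfl fun b _ => by ring
    have s2 : ∑ a, X i a * p.1 a l * star (p.2 j l) = ∑ a, X i a * (p.1 a l * star (p.2 j l)) :=
      Finset.sum_congr rfl fun a _ => by ring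
    have s3 : ∑ b, p.2 i l * (star (X j b) * star (p.1 b l)) =
        ∑ b, star (X j b) * (p.2 i l * star (p.1 b l)) :=
      Finset.sum_congr rfl fun a _ => by ring
    rw [← s1, ← s2, ← s3, Finset.sum_add_distrib, Finset.sum_comm]
    abel
  simp_rw [e]
  refine ⟨((i1.add i2).add i3).add i4, ?_⟩
  refine (integral_add ((i1.add i2).add i3) i4).trans ?_
  rw [integral_add' (i1.add i2) i3, integral_add' i1 i2,
    integral_finsetSum _ fun a _ => integrable_finsetSum _ fun b _ =>
      (integrable_mul_star (mH a) (mH b)).const_mul _,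
    integral_finsetSum _ fun a _ => (integrable_mul_star (mH a) (mZ j)).const_mul _,
    integral_finsetSum _ fun a _ => (integrable_mul_star (mZ i) (mH a)).const_mul _]
  simp_rw [integral_const_mul]
  simp_rw [eHZ, eZH, eZZ, integral_finsetSum Finset.univ fun b _ =>
      (integrable_mul_star (mH _) (mH b)).const_mul _, integral_const_mul, eHH]
  simp [Matrix.add_apply, Matrix.one_apply, Matrix.mul_apply, add_comm]

/-- The mean of a quadratic form in the output of the channel. -/
theorem integral_hermForm {n k L : ℕ} (X : Matrix (Fin n) (Fin k) ℂ)
    (W : Matrix (Fin n) (Fin n) ℂ) :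
    Integrable (fun p => hermForm W (mulArr X p.1 + p.2)) (channelLaw n k L) ∧
    ∫ p, hermForm W (mulArr X p.1 + p.2) ∂(channelLaw n k L) =
      L * (W * (1 + X * Xᴴ)).trace.re := by
  have e : ∀ Y : CArr n L, hermForm W Y =
      (∑ l, ∑ j, ∑ i, W i j * (Y j l * star (Y i l))).re := by
    intro Y
    simp only [hermForm, Matrix.trace, Matrix.mul_apply, Matrix.diag_apply, conjTranspose_apply,
      of_apply, Finset.sum_mul]
    congr 1
    exact Finset.sum_congr rfl fun l _ => Finset.sum_congr rfl fun a _ =>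
      Finset.sum_congr rfl fun b _ => by ring
  have i0 := fun (l : Fin L) (j i : Fin n) => (integral_output_mul_star X j i l).1.const_mul (W i j)
  have i1 := fun (l : Fin L) (j : Fin n) =>
    integrable_finsetSum Finset.univ fun i (_ : i ∈ Finset.univ) => i0 l j i
  have i2 := fun (l : Fin L) =>
    integrable_finsetSum Finset.univ fun j (_ : j ∈ Finset.univ) => i1 l j
  have i3 := integrable_finsetSum Finset.univ fun l (_ : l ∈ Finset.univ) => i2 l
  simp_rw [e]
  refine ⟨i3.re, ?_⟩
  refine (integral_re i3).trans ?_
  rw [integral_finsetSum _ fun l _ => i2 l]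
  simp_rw [integral_finsetSum Finset.univ fun j _ => i1 _ j,
    integral_finsetSum Finset.univ fun i _ => i0 _ _ i, integral_const_mul,
    (integral_output_mul_star X _ _ _).2]
  simp only [Finset.sum_const, Finset.card_univ, Fintype.card_fin, nsmul_eq_mul]
  rw [Finset.sum_comm]
  simp [Matrix.trace, Matrix.mul_apply]

theorem integral_energy {n k L : ℕ} (X : CArr n k) :
    Integrable (fun p => energy (mulArr (of X) p.1 + p.2)) (channelLaw n k L) ∧
    ∫ p, energy (mulArr (of X) p.1 + p.2) ∂(channelLaw n k L) = L * (n + energy X) := by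
  have h := integral_hermForm (L := L) (of X) 1
  simp_rw [hermForm_one] at h
  refine ⟨h.1, h.2.trans ?_⟩
  rw [Matrix.one_mul, trace_add, Complex.add_re, trace_one, trace_mul_comm, ← energy_eq_trace]
  simp

/-- The precision is the inverse of the covariance, so each antenna contributes the trace of the
identity whatever `X` is. -/
theorem integral_hermForm_precision {n k L : ℕ} (X : Matrix (Fin n) (Fin k) ℂ) :
    ∫ p, hermForm (precision X) (mulArr X p.1 + p.2) ∂(channelLaw n k L) = L * n := by
  rw [(integral_hermForm X _).2, precision_mul, trace_one]
  simp

/-! ### Bounds on the log-determinant -/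

theorem det_gram_eq_prod {n k : ℕ} (X : Matrix (Fin n) (Fin k) ℂ) :
    ∃ v : Fin k → ℝ, (∀ i, 0 ≤ v i) ∧ (gram X).det.re = ∏ i, (1 + v i) ∧
      (Xᴴ * X).trace.re = ∑ i, v i := by
  have hA := isHermitian_conjTranspose_mul_self X
  refine ⟨hA.eigenvalues, eigenvalues_conjTranspose_mul_self_nonneg X, ?_, ?_⟩
  · set U := hA.eigenvectorUnitary
    have h := hA.spectral_theorem
    rw [Unitary.conjStarAlgAut_apply] at h
    have hU : (U : Matrix (Fin k) (Fin k) ℂ) * star (U : Matrix (Fin k) (Fin k) ℂ) = 1 :=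
      Unitary.coe_mul_star_self U
    have h2 : gram X = (U : Matrix (Fin k) (Fin k) ℂ) *
        (1 + diagonal (RCLike.ofReal ∘ hA.eigenvalues)) *
        star (U : Matrix (Fin k) (Fin k) ℂ) := by
      rw [Matrix.mul_add, Matrix.add_mul, Matrix.mul_one, hU, gram]
      exact congrArg _ h
    have h3 : (1 : Matrix (Fin k) (Fin k) ℂ) + diagonal (RCLike.ofReal ∘ hA.eigenvalues) =
        diagonal fun i => ((1 + hA.eigenvalues i : ℝ) : ℂ) := by
      rw [← diagonal_one, diagonal_add]
      congr 1; ext i; simp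
    rw [h2, det_mul, det_mul, mul_right_comm, ← det_mul, hU, det_one, one_mul, h3, det_diagonal,
      ← Complex.ofReal_prod, Complex.ofReal_re]
  · rw [hA.trace_eq_sum_eigenvalues]
    simp

theorem log_det_gram_nonneg {n k : ℕ} (X : Matrix (Fin n) (Fin k) ℂ) :
    0 ≤ Real.log (gram X).det.re := by
  obtain ⟨v, hv, h, -⟩ := det_gram_eq_prod X
  rw [h]
  exact Real.log_nonneg (Finset.one_le_prod fun i _ => by linarith [hv i])

/-- Apply `log (1 + v) ≤ v` to each eigenvalue. As the energy has finite mean, this makes the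
log-determinant integrable. -/
theorem log_det_gram_le {n k : ℕ} (X : CArr n k) :
    Real.log (gram (of X)).det.re ≤ energy X := by
  obtain ⟨v, hv, h, ht⟩ := det_gram_eq_prod (of X)
  rw [h, energy_eq_trace, ht, Real.log_prod fun i _ => by linarith [hv i]]
  exact Finset.sum_le_sum fun i _ =>
    (Real.log_le_sub_one_of_pos (by linarith [hv i])).trans (by linarith)

/-- Sylvester's determinant identity passes from the `n × n` covariance to the `k × k` Gram matrix.
-/
theorem logDet_eq {n k : ℕ} (X : CArr n k) :
    logDet X = Real.log (gram (of X)).det.re / Real.log 2 := by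
  rw [logDet, gram, ← det_one_add_mul_comm, Real.logb]

theorem measurable_log_det_gram {n k : ℕ} :
    Measurable fun X : CArr n k => Real.log (gram (of X)).det.re := by
  have : Continuous fun X : CArr n k => (gram (of X)).det := by
    refine Continuous.matrix_det ?_
    unfold gram
    have h : Continuous fun X : CArr n k => of X := continuous_id
    fun_prop
  exact Real.measurable_log.comp (Complex.measurable_re.comp this.measurable)

/-! ### The reference density and the divergence -/

/-- The density of an array with i.i.d. `CN(0, s)` entries. -/
def refDensity {n L : ℕ} (s : ℝ) (Y : CArr n L) : ℝ :=
  Real.pi⁻¹ ^ (n * L) * (s ^ (n * L))⁻¹ * Real.exp (-(energy Y / s))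

theorem refDensity_pos {n L : ℕ} {s : ℝ} (hs : 0 < s) (Y : CArr n L) : 0 < refDensity s Y := by
  have := Real.pi_pos
  unfold refDensity; positivity

@[fun_prop]
theorem measurable_refDensity {n L : ℕ} (s : ℝ) :
    Measurable (refDensity s : CArr n L → ℝ) := by
  unfold refDensity; fun_prop

/-- Scaling by the scalar matrix `(√s)⁻¹` reduces to the standard Gaussian integral. -/
theorem lintegral_refDensity {n L : ℕ} {s : ℝ} (hs : 0 < s) :
    ∫⁻ Y : CArr n L, ENNReal.ofReal (refDensity s Y) = 1 := by
  have hpi := Real.pi_pos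
  set A : Matrix (Fin n) (Fin n) ℂ := diagonal fun _ => (((√s)⁻¹ : ℝ) : ℂ) with hA
  have hsq : √s ^ 2 = s := Real.sq_sqrt hs.le
  have hs' : 0 < √s := Real.sqrt_pos.2 hs
  have hdet : ‖A.det‖ ^ 2 = (s ^ n)⁻¹ := by
    rw [hA, det_diagonal, Finset.prod_const, Finset.card_univ, Fintype.card_fin, norm_pow,
      Complex.norm_real, Real.norm_of_nonneg (by positivity), ← pow_mul, mul_comm, pow_mul,
      inv_pow, hsq, inv_pow]
  have hA0 : A.det ≠ 0 := by
    intro h0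
    rw [h0, norm_zero] at hdet
    have : 0 < (s ^ n)⁻¹ := by positivity
    rw [← hdet] at this
    norm_num at this
  have hE : ∀ Y : CArr n L, energy Y / s = energy (mulArr A Y) := by
    intro Y
    simp only [energy, Finset.sum_div]
    refine Finset.sum_congr rfl fun i _ => Finset.sum_congr rfl fun j _ => ?_
    have : mulArr A Y i j = (((√s)⁻¹ : ℝ) : ℂ) * Y i j := by
      simp [mulArr, hA, diagonal_apply]
    rw [this, norm_mul, mul_pow, Complex.norm_real, Real.norm_of_nonneg (by positivity), inv_pow,
      hsq, div_eq_inv_mul]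
  have e : ∀ Y : CArr n L, ENNReal.ofReal (refDensity s Y) =
      ENNReal.ofReal (Real.pi⁻¹ ^ (n * L) * (s ^ (n * L))⁻¹) *
        ENNReal.ofReal (Real.exp (-energy (mulArr A Y))) := by
    intro Y
    rw [← ENNReal.ofReal_mul (by positivity), refDensity, hE]
  rw [lintegral_congr e, lintegral_const_mul _ (by fun_prop),
    lintegral_comp_mulArr A hA0 (F := fun H => ENNReal.ofReal (Real.exp (-energy H)))
      (by fun_prop), lintegral_exp_neg_energy, ← ENNReal.ofReal_mul (by positivity),
    ← ENNReal.ofReal_mul (by positivity), hdet, ENNReal.ofReal_eq_one, inv_pow, inv_pow, inv_inv,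
    pow_mul s]
  field_simp

theorem integrable_refDensity {n L : ℕ} {s : ℝ} (hs : 0 < s) :
    Integrable (refDensity s : CArr n L → ℝ) ∧ ∫ Y : CArr n L, refDensity s Y = 1 := by
  have h := lintegral_refDensity (n := n) (L := L) hs
  have h0 : 0 ≤ᵐ[volume] (refDensity s : CArr n L → ℝ) :=
    .of_forall fun Y => (refDensity_pos hs Y).le
  have hm : AEStronglyMeasurable (refDensity s : CArr n L → ℝ) :=
    (measurable_refDensity s).aestronglyMeasurable
  refine ⟨⟨hm, ?_⟩, ?_⟩
  · rw [hasFiniteIntegral_iff_ofReal h0, h]; simp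
  · rw [integral_eq_lintegral_of_nonneg_ae h0 hm, h]; simp

theorem outDensity_pos {n k : ℕ} (L : ℕ) (X : Matrix (Fin n) (Fin k) ℂ) (Y : CArr n L) :
    0 < outDensity L X Y := by
  have := Real.pi_pos
  have := det_gram_pos X
  unfold outDensity; positivity

@[fun_prop]
theorem measurable_outDensity {n k : ℕ} (L : ℕ) (X : Matrix (Fin n) (Fin k) ℂ) :
    Measurable (outDensity L X) := by
  unfold outDensity; fun_prop

/-- The relative entropy (in nats) of the law of `X H + Z` with respect to i.i.d. `CN(0, s)`. -/
def outDivergence {n k : ℕ} (L : ℕ) (s : ℝ) (X : CArr n k) : ℝ :=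
  L * (n * Real.log s + (n + energy X) / s - n - Real.log (gram (of X)).det.re)

theorem log_outDensity_sub {n k L : ℕ} {s : ℝ} (hs : 0 < s) (X : Matrix (Fin n) (Fin k) ℂ)
    (Y : CArr n L) :
    Real.log (outDensity L X Y) - Real.log (refDensity s Y) =
      n * L * Real.log s - L * Real.log (gram X).det.re + energy Y / s -
        hermForm (precision X) Y := by
  have hpi := Real.pi_pos
  have hd := det_gram_pos X
  rw [outDensity, refDensity, Real.log_mul (by positivity) (by positivity),
    Real.log_mul (by positivity) (by positivity), Real.log_mul (by positivity) (by positivity),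
    Real.log_mul (by positivity) (by positivity), Real.log_exp, Real.log_exp, Real.log_inv,
    Real.log_inv, Real.log_pow, Real.log_pow, Real.log_pow]
  push_cast
  ring

theorem integral_log_outDensity_sub {n k L : ℕ} {s : ℝ} (hs : 0 < s) (X : CArr n k) :
    Integrable (fun p => Real.log (outDensity L (of X) (mulArr (of X) p.1 + p.2)) -
      Real.log (refDensity s (mulArr (of X) p.1 + p.2))) (channelLaw n k L) ∧
    ∫ p, (Real.log (outDensity L (of X) (mulArr (of X) p.1 + p.2)) -
      Real.log (refDensity s (mulArr (of X) p.1 + p.2))) ∂(channelLaw n k L) =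
      outDivergence L s X := by
  simp_rw [log_outDensity_sub hs]
  have h1 := integral_energy (L := L) X
  have h2 := (integral_hermForm (L := L) (of X) (precision (of X))).1
  have h3 := integrable_const (μ := channelLaw n k L)
    (n * L * Real.log s - L * Real.log (gram (of X)).det.re)
  refine ⟨(h3.add (h1.1.div_const s)).sub h2, ?_⟩
  refine (integral_sub (h3.add (h1.1.div_const s)) h2).trans ?_
  rw [integral_add' h3 (h1.1.div_const s), integral_div, h1.2, integral_hermForm_precision,
    integral_const, probReal_univ, outDivergence]
  simp only [one_smul]
  ring

/-! ### The change-of-measure inequality -/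

/-- A change-of-measure inequality: the divergence dominates the mean of the logarithm of a
two-valued function, normalized with respect to the reference density. -/
theorem log_mul_add_log_mul_le {n k L : ℕ} {s α β : ℝ} (hs : 0 < s) (hα : 0 < α) (hβ : 0 < β)
    (X : CArr n k) {S : Set (CArr n L)} (hS : MeasurableSet S) :
    Real.log α * (channelLaw n k L).real {p | mulArr (of X) p.1 + p.2 ∈ S} +
      Real.log β * (channelLaw n k L).real {p | mulArr (of X) p.1 + p.2 ∉ S} ≤
    outDivergence L s X +
      (∫ Y : CArr n L, (S.indicator (fun _ => α) Y + Sᶜ.indicator (fun _ => β) Y) *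
        refDensity s Y) - 1 := by
  set φ : CArr n L → ℝ := fun Y => S.indicator (fun _ => α) Y + Sᶜ.indicator (fun _ => β) Y with hφ
  set μ := channelLaw n k L
  set out : CArr k L × CArr n L → CArr n L := fun p => mulArr (of X) p.1 + p.2 with hout
  have hom : Measurable out := by fun_prop
  have hφm : Measurable φ := (measurable_const.indicator hS).add (measurable_const.indicator hS.compl)
  have hφpos : ∀ Y, 0 < φ Y := by
    intro Y
    by_cases h : Y ∈ S
    · simp [hφ, h, hα]
    · simp [hφ, h, hβ]
  have hφle : ∀ Y, φ Y ≤ α + β := by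
    intro Y
    by_cases h : Y ∈ S
    · simp [hφ, h, hβ.le]
    · simp [hφ, h, hα.le]
  obtain ⟨hq, -⟩ := integrable_refDensity (n := n) (L := L) hs
  have hφq : Integrable fun Y => φ Y * refDensity s Y :=
    hq.bdd_mul (c := α + β) hφm.aestronglyMeasurable (.of_forall fun Y => by
      rw [Real.norm_of_nonneg (hφpos Y).le]; exact hφle Y)
  -- This is `φ q / p`, with mean under the output law equal to the integral of `φ q`, since `p` is
  -- positive everywhere.
  set ρ : CArr n L → ℝ := fun Y => φ Y * refDensity s Y / outDensity L (of X) Y with hρ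
  have hρm : Measurable ρ := by fun_prop
  have hρpos : ∀ Y, 0 < ρ Y := fun Y =>
    div_pos (mul_pos (hφpos Y) (refDensity_pos hs Y)) (outDensity_pos L _ Y)
  have hlin : ∫⁻ p, ENNReal.ofReal (ρ (out p)) ∂μ =
      ∫⁻ Y, ENNReal.ofReal (φ Y * refDensity s Y) := by
    rw [lintegral_channelLaw (of X) (g := fun Y => ENNReal.ofReal (ρ Y)) (by fun_prop)]
    refine lintegral_congr fun Y => ?_
    rw [← ENNReal.ofReal_mul (hρpos Y).le, hρ]
    simp only
    rw [div_mul_cancel₀ _ (outDensity_pos L _ Y).ne']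
  have h0 : 0 ≤ᵐ[volume] fun Y => φ Y * refDensity s Y :=
    .of_forall fun Y => (mul_pos (hφpos Y) (refDensity_pos hs Y)).le
  have h0' : 0 ≤ᵐ[μ] fun p => ρ (out p) := .of_forall fun p => (hρpos _).le
  have hρint : Integrable (fun p => ρ (out p)) μ := by
    refine ⟨(hρm.comp hom).aestronglyMeasurable, ?_⟩
    rw [hasFiniteIntegral_iff_ofReal h0', hlin, ← hasFiniteIntegral_iff_ofReal h0]
    exact hφq.2
  have hρeq : ∫ p, ρ (out p) ∂μ = ∫ Y, φ Y * refDensity s Y := by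
    rw [integral_eq_lintegral_of_nonneg_ae h0' (hρm.comp hom).aestronglyMeasurable, hlin,
      integral_eq_lintegral_of_nonneg_ae h0 hφq.1]
  obtain ⟨hd, hdeq⟩ := integral_log_outDensity_sub (L := L) hs X
  have hlog : ∀ Y, Real.log (φ Y) = S.indicator (fun _ => Real.log α) Y +
      Sᶜ.indicator (fun _ => Real.log β) Y := by
    intro Y
    by_cases h : Y ∈ S <;> simp [hφ, h]
  have hmS : MeasurableSet {p | out p ∈ S} := hom hS
  have hmS' : MeasurableSet {p | out p ∉ S} := hom hS.compl
  have iα : Integrable ({p | out p ∈ S}.indicator fun _ => Real.log α) μ :=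
    (integrable_const _).indicator hmS
  have iβ : Integrable ({p | out p ∉ S}.indicator fun _ => Real.log β) μ :=
    (integrable_const _).indicator hmS'
  have hφeq : ∫ p, ({p | out p ∈ S}.indicator (fun _ => Real.log α) p +
      {p | out p ∉ S}.indicator (fun _ => Real.log β) p) ∂μ =
      Real.log α * μ.real {p | out p ∈ S} + Real.log β * μ.real {p | out p ∉ S} := by
    rw [integral_add iα iβ, integral_indicator_const _ hmS, integral_indicator_const _ hmS',
      smul_eq_mul, smul_eq_mul, mul_comm, mul_comm (Real.log β)]
  rw [← hφeq, ← hdeq, ← hρeq]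
  have hpt : ∀ p, {p | out p ∈ S}.indicator (fun _ => Real.log α) p +
      {p | out p ∉ S}.indicator (fun _ => Real.log β) p ≤
      (Real.log (outDensity L (of X) (out p)) - Real.log (refDensity s (out p))) +
        (ρ (out p) - 1) := by
    intro p
    have e : {p | out p ∈ S}.indicator (fun _ => Real.log α) p +
      {p | out p ∉ S}.indicator (fun _ => Real.log β) p = Real.log (φ (out p)) := (hlog _).symm
    -- The only inequality of the argument; integrating it gives the claim.
    have h1 := Real.log_le_sub_one_of_pos (hρpos (out p))
    have h2 : Real.log (ρ (out p)) = Real.log (φ (out p)) + Real.log (refDensity s (out p)) -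
        Real.log (outDensity L (of X) (out p)) := by
      rw [hρ]
      simp only
      rw [Real.log_div (mul_pos (hφpos _) (refDensity_pos hs _)).ne' (outDensity_pos L _ _).ne',
        Real.log_mul (hφpos _).ne' (refDensity_pos hs _).ne']
    rw [e]
    linarith
  have := integral_mono (iα.add iβ) (hd.add (hρint.sub (integrable_const 1))) hpt
  refine this.trans (le_of_eq ?_)
  rw [integral_add' hd (hρint.sub (integrable_const 1)), integral_sub' hρint (integrable_const 1),
    integral_const, probReal_univ]
  simp only [smul_eq_mul, one_mul]
  ring

/-! ### Summing over tuples of distinct messages -/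

/-- The codewords selected by the active users. -/
def selected {n M Ka : ℕ} (x : CArr n M) (w : Fin Ka → Fin M) : CArr n Ka := fun i k => x i (w k)

theorem received_eq {n M Ka L : ℕ} (x : CArr n M) (w : Fin Ka → Fin M) (H : CArr Ka L)
    (Z : CArr n L) : received x w H Z = mulArr (of (selected x w)) H + Z := by
  ext i l
  simp [received, mulArr, selected, mul_comm]

/-- A distinct tuple with image `D` is an injection of `Fin Ka` into `D`, and there are `Ka!` of
these. -/
theorem card_embedding_map_eq {M Ka : ℕ} (D : Finset (Fin M)) (hD : D.card = Ka) :
    (Finset.univ.filter fun w : Fin Ka ↪ Fin M => Finset.univ.image w = D).card ≤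
      Ka.factorial := by
  have hc : Fintype.card (Fin Ka ↪ D) = Ka.factorial := by
    rw [Fintype.card_embedding_eq, Fintype.card_coe, hD, Fintype.card_fin, Nat.descFactorial_self]
  rw [← hc, ← Fintype.card_subtype]
  refine Fintype.card_le_of_injective (fun w => ⟨fun k => ⟨w.1 k, ?_⟩, ?_⟩) ?_
  · have h : w.1 k ∈ Finset.univ.image w.1 := Finset.mem_image_of_mem _ (Finset.mem_univ k)
    rwa [w.2] at h
  · intro a b hab
    exact w.1.injective (congrArg Subtype.val hab)
  · intro w v hwv
    refine Subtype.ext (DFunLike.ext _ _ fun k => ?_)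
    exact congrArg Subtype.val (DFunLike.congr_fun hwv k)

theorem card_embedding_eq_choose {M Ka : ℕ} :
    (Fintype.card (Fin Ka ↪ Fin M) : ℝ) = Ka.factorial * M.choose Ka := by
  rw [Fintype.card_embedding_eq, Fintype.card_fin, Fintype.card_fin,
    Nat.descFactorial_eq_factorial_mul_choose]
  push_cast; rfl

/-- The error probability for a fixed codebook, a fixed decoder and fixed messages. -/
def condError {n M Ka L : ℕ} (x : CArr n M) (dec : CArr n L → Finset (Fin M))
    (w : Fin Ka → Fin M) : ℝ :=
  (channelLaw n Ka L).real {p | Finset.univ.image w ≠ dec (received x w p.1 p.2)}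

/-- The Fano-type inequality for a fixed codebook, summed over the tuples of distinct messages. -/
theorem sum_log_condError_le {n M Ka L : ℕ} (hKa : Ka ≤ M) {s e : ℝ} (hs : 0 < s) (he0 : 0 < e)
    (he1 : e < 1) (x : CArr n M) {dec : CArr n L → Finset (Fin M)} (hdec : Measurable dec)
    (hcard : ∀ Y, (dec Y).card = Ka) :
    ∑ w : Fin Ka ↪ Fin M, (Real.log ((1 - e) * M.choose Ka) * (1 - condError x dec w) +
      Real.log e * condError x dec w) ≤
    ∑ w : Fin Ka ↪ Fin M, outDivergence L s (selected x w) := by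
  have hC : (0 : ℝ) < M.choose Ka := by exact_mod_cast Nat.choose_pos hKa
  -- With `N = Ka! * M.choose Ka` distinct tuples, this value makes `N * e + Ka! * α = N`, so the
  -- test functions have total at most `N`.
  set α : ℝ := (1 - e) * M.choose Ka with hα
  have hα0 : 0 < α := mul_pos (by linarith) hC
  set S : (Fin Ka ↪ Fin M) → Set (CArr n L) := fun w => {Y | Finset.univ.image w = dec Y} with hSdef
  have hS : ∀ w, MeasurableSet (S w) := fun w => by
    have : S w = dec ⁻¹' {Finset.univ.image w} := by ext; simp [hSdef, eq_comm]
    rw [this]; exact hdec (measurableSet_singleton _)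
  have key := fun w : Fin Ka ↪ Fin M => log_mul_add_log_mul_le hs hα0 he0 (selected x w) (hS w)
  have hE : ∀ w : Fin Ka ↪ Fin M, (channelLaw n Ka L).real
      {p | mulArr (of (selected x w)) p.1 + p.2 ∉ S w} = condError x dec w := by
    intro w
    simp only [condError, received_eq]
    rfl
  have hE' : ∀ w : Fin Ka ↪ Fin M, (channelLaw n Ka L).real
      {p | mulArr (of (selected x w)) p.1 + p.2 ∈ S w} = 1 - condError x dec w := by
    intro w
    have hm : Measurable fun p : CArr Ka L × CArr n L =>
      mulArr (of (selected x w)) p.1 + p.2 := by fun_prop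
    have := probReal_add_probReal_compl (μ := channelLaw n Ka L) (hm (hS w))
    have h2 := hE w
    rw [← h2]
    exact eq_sub_of_add_eq this
  simp_rw [hE, hE'] at key
  obtain ⟨hq, hq1⟩ := integrable_refDensity (n := n) (L := L) hs
  have hφq : ∀ w, Integrable fun Y => ((S w).indicator (fun _ => α) Y +
      (S w)ᶜ.indicator (fun _ => e) Y) * refDensity s Y := fun w => by
    simp_rw [add_mul]
    refine Integrable.add ?_ ?_
    · simp_rw [← Set.indicator_mul_left]
      exact (hq.const_mul α).indicator (hS w)
    · simp_rw [← Set.indicator_mul_left]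
      exact (hq.const_mul e).indicator (hS w).compl
  -- Every tuple contributes at most `e`, and only the at most `Ka!` tuples with the decoded image
  -- contribute a further `α`.
  have hcount : ∀ Y, ∑ w, ((S w).indicator (fun _ => α) Y + (S w)ᶜ.indicator (fun _ => e) Y) ≤
      Fintype.card (Fin Ka ↪ Fin M) := by
    intro Y
    have e1 : ∀ w, (S w).indicator (fun _ => α) Y + (S w)ᶜ.indicator (fun _ => e) Y ≤
        e + if Finset.univ.image w = dec Y then α else 0 := by
      intro w
      by_cases h : Finset.univ.image w = dec Y
      · have h' : Y ∈ S w := h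
        simp [h', h, he0.le]
      · have h' : Y ∉ S w := h
        simp [h', h]
    refine (Finset.sum_le_sum fun w _ => e1 w).trans ?_
    rw [Finset.sum_add_distrib, ← Finset.sum_filter, Finset.sum_const, Finset.sum_const,
      nsmul_eq_mul, nsmul_eq_mul, Finset.card_univ]
    have h1 : ((Finset.univ.filter fun w : Fin Ka ↪ Fin M =>
        Finset.univ.image w = dec Y).card : ℝ) ≤ Ka.factorial := by
      exact_mod_cast card_embedding_map_eq (dec Y) (hcard Y)
    have h2 := mul_le_mul_of_nonneg_right h1 hα0.le
    have h3 : (Ka.factorial : ℝ) * α = (1 - e) * Fintype.card (Fin Ka ↪ Fin M) := by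
      rw [card_embedding_eq_choose, hα]; ring
    linarith
  have hsum : ∑ w, ∫ Y, ((S w).indicator (fun _ => α) Y + (S w)ᶜ.indicator (fun _ => e) Y) *
      refDensity s Y ≤ Fintype.card (Fin Ka ↪ Fin M) := by
    rw [← integral_finsetSum _ fun w _ => hφq w]
    calc _ ≤ ∫ Y : CArr n L, (Fintype.card (Fin Ka ↪ Fin M) : ℝ) * refDensity s Y := by
          refine integral_mono (integrable_finsetSum _ fun w _ => hφq w) (hq.const_mul _) fun Y => ?_
          simp only
          rw [← Finset.sum_mul]
          exact mul_le_mul_of_nonneg_right (hcount Y) (refDensity_pos hs Y).le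
      _ = _ := by rw [integral_const_mul, hq1, mul_one]
  have := Finset.sum_le_sum fun w (_ : w ∈ Finset.univ) => key w
  rw [Finset.sum_sub_distrib, Finset.sum_add_distrib (f := fun w : Fin Ka ↪ Fin M =>
    outDivergence L s (selected x w)), Finset.sum_const, Finset.card_univ,
    nsmul_eq_mul, mul_one] at this
  linarith

/-! ### Averaging over the random codebook -/

theorem map_pi_precomp {a b : ℕ} (ν : Measure ℂ) [IsProbabilityMeasure ν] {w : Fin a → Fin b}
    (hw : Function.Injective w) :
    (Measure.pi fun _ : Fin b => ν).map (fun y k => y (w k)) = Measure.pi fun _ : Fin a => ν := by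
  have hi := iIndepFun_pi (μ := fun _ : Fin b => ν) (X := fun _ (y : ℂ) => y)
    (fun _ => aemeasurable_id)
  have h2 := hi.precomp hw
  rw [iIndepFun_iff_map_fun_eq_pi_map fun k => (measurable_pi_apply (w k)).aemeasurable] at h2
  refine h2.trans (congrArg _ (funext fun k => ?_))
  exact (measurePreserving_eval (fun _ : Fin b => ν) (w k)).map_eq

@[fun_prop]
theorem measurable_selected {n M Ka : ℕ} (w : Fin Ka → Fin M) :
    Measurable fun x : CArr n M => selected x w := by
  unfold selected; fun_prop

/-- Injectivity is essential: a repeated message would repeat a column and destroy independence.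
This is why the argument is restricted to distinct tuples. -/
theorem map_selected {n M Ka : ℕ} (ν : Measure ℂ) [IsProbabilityMeasure ν] {w : Fin Ka → Fin M}
    (hw : Function.Injective w) :
    (iidArr n M ν).map (fun x => selected x w) = iidArr n Ka ν := by
  have h := Measure.pi_map_pi (μ := fun _ : Fin n => Measure.pi fun _ : Fin M => ν)
    (f := fun _ (y : Fin M → ℂ) (k : Fin Ka) => y (w k))
    (hμ := fun _ => by rw [map_pi_precomp ν hw]; infer_instance)
    (fun _ => Measurable.aemeasurable (by fun_prop))
  simp_rw [map_pi_precomp ν hw] at h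
  exact h

theorem integral_energy_iidArr {n k : ℕ} {ν : Measure ℂ} {P : ℝ} (hν : IsEntryLaw ν P) :
    Integrable (energy : CArr n k → ℝ) (iidArr n k ν) ∧
      ∫ X, energy X ∂(iidArr n k ν) = n * k * P := by
  have := hν.prob
  have h0 : Integrable (fun z : ℂ => ‖z‖ ^ 2) ν :=
    (memLp_two_iff_integrable_sq_norm hν.sq_integrable.1).1 hν.sq_integrable
  have h1 : ∀ i j, Integrable (fun X : CArr n k => ‖X i j‖ ^ 2) (iidArr n k ν) := fun i j =>
    integrable_comp_eval (μ := fun _ : Fin n => Measure.pi fun _ : Fin k => ν)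
      (f := fun y : Fin k → ℂ => ‖y j‖ ^ 2)
      (integrable_comp_eval (μ := fun _ : Fin k => ν) h0)
  have h2 := fun i => integrable_finsetSum Finset.univ fun j (_ : j ∈ Finset.univ) => h1 i j
  refine ⟨integrable_finsetSum _ fun i _ => h2 i, ?_⟩
  unfold energy
  rw [integral_finsetSum _ fun i _ => h2 i]
  simp_rw [integral_finsetSum Finset.univ fun j _ => h1 _ j]
  simp_rw [integral_comp_arr _ _ (f := fun z : ℂ => ‖z‖ ^ 2)
    (Continuous.stronglyMeasurable (by fun_prop)), hν.variance]
  simp [mul_assoc]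

theorem integrable_log_det_gram {n k : ℕ} {ν : Measure ℂ} {P : ℝ} (hν : IsEntryLaw ν P) :
    Integrable (fun X : CArr n k => Real.log (gram (of X)).det.re) (iidArr n k ν) := by
  refine (integral_energy_iidArr hν).1.mono' measurable_log_det_gram.aestronglyMeasurable
    (.of_forall fun X => ?_)
  rw [Real.norm_of_nonneg (log_det_gram_nonneg _)]
  exact log_det_gram_le X

theorem integrable_logDet {n k : ℕ} {ν : Measure ℂ} {P : ℝ} (hν : IsEntryLaw ν P) :
    Integrable (fun X : CArr n k => logDet X) (iidArr n k ν) := by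
  simp_rw [logDet_eq]
  exact (integrable_log_det_gram hν).div_const _

/-- The mean energy is `n * k * P`, so at `s = 1 + k * P` the term `(n + energy X) / s` averages to
`n` and cancels the `-n`. -/
theorem integral_outDivergence {n k L : ℕ} {ν : Measure ℂ} {P : ℝ} (hν : IsEntryLaw ν P)
    (hP : 0 < P) :
    Integrable (fun X : CArr n k => outDivergence L (1 + k * P) X) (iidArr n k ν) ∧
    ∫ X, outDivergence L (1 + k * P) X ∂(iidArr n k ν) =
      L * (n * Real.log (1 + k * P) -
        ∫ X : CArr n k, Real.log (gram (of X)).det.re ∂(iidArr n k ν)) := by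
  have := hν.prob
  have hs : (0 : ℝ) < 1 + k * P := by positivity
  obtain ⟨h1, h1'⟩ := integral_energy_iidArr (n := n) (k := k) hν
  have h2 := integrable_log_det_gram (n := n) (k := k) hν
  have h3 := integrable_const (μ := iidArr n k ν)
    (n * Real.log (1 + k * P) + n / (1 + k * P) - n)
  have e : ∀ X : CArr n k, outDivergence L (1 + k * P) X =
      L * ((n * Real.log (1 + k * P) + n / (1 + k * P) - n) + energy X / (1 + k * P) -
        Real.log (gram (of X)).det.re) := fun X => by
    rw [outDivergence]; ring
  simp_rw [e]
  have h4 := (h3.add (h1.div_const (1 + k * P))).sub h2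
  refine ⟨h4.const_mul _, ?_⟩
  rw [integral_const_mul]
  congr 1
  refine (integral_sub (h3.add (h1.div_const _)) h2).trans ?_
  rw [integral_add' h3 (h1.div_const _), integral_div, h1', integral_const, probReal_univ]
  simp only [one_smul]
  congr 1
  field_simp
  ring

/-! ### The joint error as an average over messages -/

variable {n M Ka L : ℕ}

theorem condError_nonneg (x : CArr n M) (dec : CArr n L → Finset (Fin M)) (w : Fin Ka → Fin M) :
    0 ≤ condError x dec w := measureReal_nonneg

theorem condError_le_one (x : CArr n M) (dec : CArr n L → Finset (Fin M)) (w : Fin Ka → Fin M) :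
    condError x dec w ≤ 1 := measureReal_le_one

theorem measurableSet_error (C : EnsembleCode n M Ka L) (w : Fin Ka → Fin M) :
    MeasurableSet {q : C.U × CArr Ka L × CArr n L |
      Finset.univ.image w ≠ C.decode q.1 (received (C.codebook q.1) w q.2.1 q.2.2)} := by
  have hcb := C.measurable_codebook
  have hr : Measurable fun q : C.U × CArr Ka L × CArr n L =>
      received (C.codebook q.1) w q.2.1 q.2.2 := by
    unfold received
    have : ∀ i m, Measurable fun q : C.U × CArr Ka L × CArr n L => C.codebook q.1 i m :=
      fun i m => (measurable_pi_apply m).comp ((measurable_pi_apply i).comp (hcb.comp measurable_fst))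
    refine measurable_pi_lambda _ fun i => measurable_pi_lambda _ fun l => ?_
    refine Measurable.add (Finset.measurable_sum _ fun k _ => Measurable.mul ?_ (this i _)) ?_ <;>
      fun_prop
  have hd := C.measurable_decode.comp (measurable_fst.prodMk hr)
  have : {q : C.U × CArr Ka L × CArr n L |
      Finset.univ.image w ≠ C.decode q.1 (received (C.codebook q.1) w q.2.1 q.2.2)} =
      ((fun q : C.U × CArr Ka L × CArr n L =>
        C.decode q.1 (received (C.codebook q.1) w q.2.1 q.2.2)) ⁻¹' {Finset.univ.image w})ᶜ := by
    ext; simp [eq_comm]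
  rw [this]
  exact (hd (measurableSet_singleton _)).compl

theorem measurable_condError (C : EnsembleCode n M Ka L) (w : Fin Ka → Fin M) :
    Measurable fun u => condError (C.codebook u) (C.decode u) w :=
  (measurable_measure_prodMk_left (ν := channelLaw n Ka L) (measurableSet_error C w)).ennreal_toReal

theorem integrable_condError (C : EnsembleCode n M Ka L) (w : Fin Ka → Fin M) :
    Integrable (fun u => condError (C.codebook u) (C.decode u) w) C.law :=
  Integrable.of_bound (measurable_condError C w).aestronglyMeasurable 1 (.of_forall fun u => by
    rw [Real.norm_of_nonneg (condError_nonneg _ _ _)]; exact condError_le_one _ _ _)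

theorem messageLaw_singleton [NeZero M] (w : Fin Ka → Fin M) :
    messageLaw M Ka {w} = ENNReal.ofReal ((M : ℝ) ^ Ka)⁻¹ := by
  have hM : (0 : ℝ) < M := by exact_mod_cast NeZero.pos M
  have h1 : ∀ m : Fin M, uniformOn Set.univ {m} = 1 / (M : ℝ≥0∞) := fun m => by
    rw [uniformOn_univ, Measure.count_singleton, Fintype.card_fin]
  rw [messageLaw, Measure.pi_singleton, Finset.prod_congr rfl fun k _ => h1 (w k),
    Finset.prod_const, Finset.card_univ, Fintype.card_fin, ← inv_pow,
    ENNReal.ofReal_pow (by positivity), ENNReal.ofReal_inv_of_pos hM, ENNReal.ofReal_natCast,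
    one_div]

/-- The joint error probability is the average of the conditional error probabilities. -/
theorem jointError_eq [NeZero M] (C : EnsembleCode n M Ka L) :
    C.jointError = ((M : ℝ) ^ Ka)⁻¹ *
      ∑ w : Fin Ka → Fin M, ∫ u, condError (C.codebook u) (C.decode u) w ∂C.law := by
  set E : Set (C.U × (Fin Ka → Fin M) × CArr Ka L × CArr n L) :=
    {ω | Finset.univ.image ω.2.1 ≠
      C.decode ω.1 (received (C.codebook ω.1) ω.2.1 ω.2.2.1 ω.2.2.2)} with hE
  have hEm : MeasurableSet E := by
    have : E = ⋃ w : Fin Ka → Fin M, ((fun ω : C.U × (Fin Ka → Fin M) × CArr Ka L × CArr n L =>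
        (ω.1, ω.2.2)) ⁻¹' {q : C.U × CArr Ka L × CArr n L | Finset.univ.image w ≠
          C.decode q.1 (received (C.codebook q.1) w q.2.1 q.2.2)}) ∩ (fun ω => ω.2.1) ⁻¹' {w} := by
      ext ω
      simp [hE]
    rw [this]
    exact MeasurableSet.iUnion fun w =>
      ((by fun_prop : Measurable fun ω : C.U × (Fin Ka → Fin M) × CArr Ka L × CArr n L =>
        (ω.1, ω.2.2)) (measurableSet_error C w)).inter
      ((by fun_prop : Measurable fun ω : C.U × (Fin Ka → Fin M) × CArr Ka L × CArr n L => ω.2.1)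
        (measurableSet_singleton w))
  have hmsg : IsProbabilityMeasure (messageLaw M Ka) := by
    have : Nonempty (Fin M) := ⟨⟨0, NeZero.pos M⟩⟩
    unfold messageLaw
    have : IsProbabilityMeasure (uniformOn (Set.univ : Set (Fin M))) :=
      isProbabilityMeasure_uniformOn Set.finite_univ Set.univ_nonempty
    infer_instance
  have h1 : C.jointLaw E = ENNReal.ofReal (((M : ℝ) ^ Ka)⁻¹ *
      ∑ w : Fin Ka → Fin M, ∫ u, condError (C.codebook u) (C.decode u) w ∂C.law) := by
    change (C.law.prod ((messageLaw M Ka).prod (channelLaw n Ka L))) E = _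
    rw [Measure.prod_apply hEm]
    have e : ∀ u, ((messageLaw M Ka).prod (channelLaw n Ka L)) (Prod.mk u ⁻¹' E) =
        ∑ w : Fin Ka → Fin M, ENNReal.ofReal ((M : ℝ) ^ Ka)⁻¹ *
          ENNReal.ofReal (condError (C.codebook u) (C.decode u) w) := by
      intro u
      rw [Measure.prod_apply (measurable_prodMk_left hEm), lintegral_fintype]
      refine Finset.sum_congr rfl fun w _ => ?_
      rw [messageLaw_singleton, mul_comm, condError, measureReal_def,
        ENNReal.ofReal_toReal (measure_ne_top _ _)]
      rfl
    simp_rw [e]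
    rw [lintegral_finsetSum _ fun w _ =>
      ((measurable_condError C w).ennreal_ofReal).const_mul _, Finset.mul_sum,
      ENNReal.ofReal_sum_of_nonneg fun w _ => mul_nonneg (by positivity)
        (integral_nonneg fun u => condError_nonneg _ _ _)]
    refine Finset.sum_congr rfl fun w _ => ?_
    rw [lintegral_const_mul _ (measurable_condError C w).ennreal_ofReal,
      ENNReal.ofReal_mul (by positivity),
      ofReal_integral_eq_lintegral_ofReal (integrable_condError C w)
        (.of_forall fun u => condError_nonneg _ _ _)]
  rw [EnsembleCode.jointError, measureReal_def, h1, ENNReal.toReal_ofReal]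
  exact mul_nonneg (by positivity)
    (Finset.sum_nonneg fun w _ => integral_nonneg fun u => condError_nonneg _ _ _)

/-- Tuples with repeated messages have nonnegative error and are dropped from the average over all
`M ^ Ka` tuples. -/
theorem sum_embedding_condError_le (hM : 0 < M) (C : EnsembleCode n M Ka L) :
    ∑ w : Fin Ka ↪ Fin M, ∫ u, condError (C.codebook u) (C.decode u) w ∂C.law ≤
      (M : ℝ) ^ Ka * C.jointError := by
  have : NeZero M := ⟨hM.ne'⟩
  have hM' : (0 : ℝ) < M := by exact_mod_cast hM
  rw [jointError_eq, mul_inv_cancel_left₀ (by positivity)]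
  set f : (Fin Ka → Fin M) → ℝ := fun w =>
    ∫ u, condError (C.codebook u) (C.decode u) w ∂C.law with hf
  have h0 : ∀ w, 0 ≤ f w := fun w => integral_nonneg fun u => condError_nonneg _ _ _
  have e : ∑ w : Fin Ka ↪ Fin M, f w =
      ∑ w ∈ Finset.univ.map ⟨fun w : Fin Ka ↪ Fin M => (w : Fin Ka → Fin M),
        DFunLike.coe_injective⟩, f w := by rw [Finset.sum_map]; rfl
  change ∑ w : Fin Ka ↪ Fin M, f w ≤ ∑ w, f w
  rw [e]
  exact Finset.sum_le_sum_of_subset_of_nonneg (Finset.subset_univ _) fun w _ _ => h0 w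

/-! ### The Fano inequality and the converse -/

/-- The Fano-type inequality, in nats, at a positive error level. -/
theorem fano_nats (hKa : Ka ≤ M) {ν : Measure ℂ} {P e : ℝ} (hν : IsEntryLaw ν P) (hP : 0 < P)
    (C : EnsembleCode n M Ka L) (hC : C.HasIIDEntries ν) (he0 : 0 < e)
    (he : e ≤ (M.choose Ka : ℝ) / (1 + (M.choose Ka : ℝ)))
    (herr : ∑ w : Fin Ka ↪ Fin M, ∫ u, condError (C.codebook u) (C.decode u) w ∂C.law ≤
      Fintype.card (Fin Ka ↪ Fin M) * e) :
    (1 - e) * Real.log (M.choose Ka) - Real.binEntropy e ≤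
      L * (n * Real.log (1 + Ka * P) -
        ∫ X : CArr n Ka, Real.log (gram (of X)).det.re ∂(iidArr n Ka ν)) := by
  have := hν.prob
  have hc : (0 : ℝ) < M.choose Ka := by exact_mod_cast Nat.choose_pos hKa
  have hs : (0 : ℝ) < 1 + Ka * P := by positivity
  have he' : e * (1 + (M.choose Ka : ℝ)) ≤ M.choose Ka := (le_div_iff₀ (by positivity)).1 he
  have he1 : e < 1 := by nlinarith
  obtain ⟨hd, hdeq⟩ := integral_outDivergence (n := n) (k := Ka) (L := L) hν hP
  have hsel : ∀ w : Fin Ka ↪ Fin M,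
      Integrable (fun u => outDivergence L (1 + Ka * P) (selected (C.codebook u) w)) C.law ∧
      ∫ u, outDivergence L (1 + Ka * P) (selected (C.codebook u) w) ∂C.law =
        ∫ X, outDivergence L (1 + Ka * P) X ∂(iidArr n Ka ν) := by
    intro w
    have hm : C.law.map (fun u => selected (C.codebook u) w) = iidArr n Ka ν := by
      rw [← map_selected ν w.injective, ← hC,
        Measure.map_map (measurable_selected w) C.measurable_codebook]
      rfl
    have hmeas : Measurable fun u => selected (C.codebook u) w :=
      (measurable_selected w).comp C.measurable_codebook
    rw [← hm] at hd ⊢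
    exact ⟨(integrable_map_measure hd.1 hmeas.aemeasurable).1 hd,
      (integral_map hmeas.aemeasurable hd.1).symm⟩
  set a := Real.log ((1 - e) * M.choose Ka)
  set b := Real.log e
  set N : ℝ := (Fintype.card (Fin Ka ↪ Fin M) : ℝ) with hN
  have hNpos : 0 < N := by
    rw [hN, card_embedding_eq_choose]
    have : (0 : ℝ) < Ka.factorial := by exact_mod_cast Nat.factorial_pos Ka
    positivity
  -- This is where the threshold on the error level enters: `e ≤ (1 - e) * M.choose Ka` is
  -- equivalent to `e ≤ C / (1 + C)` with `C = M.choose Ka`. It makes the left side decreasing in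
  -- the error, so the true error may be replaced by its upper bound.
  have hab : b ≤ a := Real.log_le_log he0 (by linarith)
  have hterm : ∀ w : Fin Ka ↪ Fin M, Integrable (fun u =>
      a * (1 - condError (C.codebook u) (C.decode u) w) +
        b * condError (C.codebook u) (C.decode u) w) C.law := fun w =>
    (((integrable_const 1).sub (integrable_condError C w)).const_mul a).add
      ((integrable_condError C w).const_mul b)
  have hterm' : ∀ w : Fin Ka ↪ Fin M, ∫ u,
      (a * (1 - condError (C.codebook u) (C.decode u) w) +
        b * condError (C.codebook u) (C.decode u) w) ∂C.law =
      a - (a - b) * ∫ u, condError (C.codebook u) (C.decode u) w ∂C.law := fun w => by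
    have i1 := integrable_condError C w
    have e1 : ∀ u, a * (1 - condError (C.codebook u) (C.decode u) w) +
        b * condError (C.codebook u) (C.decode u) w =
        a - (a - b) * condError (C.codebook u) (C.decode u) w := fun u => by ring
    simp_rw [e1]
    rw [integral_sub (integrable_const a) (i1.const_mul (a - b)), integral_const_mul,
      integral_const, probReal_univ, one_smul]
  have hint := integral_mono (μ := C.law) (integrable_finsetSum Finset.univ fun w _ => hterm w)
    (integrable_finsetSum Finset.univ fun w _ => (hsel w).1) fun u =>
      sum_log_condError_le (L := L) hKa hs he0 he1 (C.codebook u) (dec := C.decode u)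
        (C.measurable_decode.comp measurable_prodMk_left) (C.card_decode u)
  rw [integral_finsetSum _ fun w _ => hterm w, integral_finsetSum _ fun w _ => (hsel w).1,
    Finset.sum_congr rfl fun w _ => hterm' w, Finset.sum_congr rfl fun w _ => (hsel w).2,
    Finset.sum_sub_distrib, Finset.sum_const, Finset.sum_const, ← Finset.mul_sum,
    Finset.card_univ, nsmul_eq_mul, nsmul_eq_mul, ← hN, hdeq] at hint
  have h1 := mul_le_mul_of_nonneg_left herr (sub_nonneg.2 hab)
  have h2 : N * ((1 - e) * a + e * b) ≤ N * (L * (n * Real.log (1 + Ka * P) -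
      ∫ X : CArr n Ka, Real.log (gram (of X)).det.re ∂(iidArr n Ka ν))) := by
    refine le_trans ?_ hint
    linarith
  refine le_trans (le_of_eq ?_) (le_of_mul_le_mul_left h2 hNpos)
  simp only [a, b]
  rw [Real.log_mul (by linarith) hc.ne', Real.binEntropy, Real.log_inv, Real.log_inv]
  ring

theorem fanoCondition (hM : 2 ≤ M) (hKa : Ka ≤ M) {ν : Measure ℂ} {P ε : ℝ}
    (hν : IsEntryLaw ν P) (hP : 0 < P) (hε₀ : 0 ≤ ε)
    (hε : ε ≤ (M.choose Ka : ℝ) / (1 + (M.choose Ka : ℝ)) * distinctRatio M Ka)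
    (C : EnsembleCode n M Ka L) (hC : C.HasIIDEntries ν) (hCε : C.jointError ≤ ε) :
    FanoCondition n M Ka L ε P ν := by
  have hc : (0 : ℝ) < M.choose Ka := by exact_mod_cast Nat.choose_pos hKa
  have hM' : (0 : ℝ) < M := by exact_mod_cast (by omega : 0 < M)
  have hf1 : (0 : ℝ) < Ka.factorial := by exact_mod_cast Nat.factorial_pos Ka
  have hf2 : (0 : ℝ) < (M - Ka).factorial := by exact_mod_cast Nat.factorial_pos _
  have hfac : (M.choose Ka : ℝ) * Ka.factorial * (M - Ka).factorial = M.factorial := by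
    exact_mod_cast Nat.choose_mul_factorial_mul_factorial hKa
  set e₀ := enlargedError M Ka ε with he₀
  have hN0 := card_embedding_eq_choose (M := M) (Ka := Ka)
  set N : ℝ := (Fintype.card (Fin Ka ↪ Fin M) : ℝ) with hN
  -- The enlarged level is exactly what spreads the total error `M ^ Ka * ε` evenly over the `N`
  -- distinct tuples.
  have hNe : N * e₀ = (M : ℝ) ^ Ka * ε := by
    rw [he₀, enlargedError, hN0, ← hfac]
    field_simp
  have he₀0 : 0 ≤ e₀ := by
    rw [he₀, enlargedError]; positivity
  have he₀1 : e₀ ≤ (M.choose Ka : ℝ) / (1 + (M.choose Ka : ℝ)) := by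
    have h1 : e₀ = ε / distinctRatio M Ka := by
      rw [he₀, enlargedError, distinctRatio, div_div_eq_mul_div, mul_assoc]
    have h2 : 0 < distinctRatio M Ka := by
      rw [distinctRatio, ← hfac]; positivity
    rw [h1, div_le_iff₀ h2]
    exact hε
  have herr : ∑ w : Fin Ka ↪ Fin M, ∫ u, condError (C.codebook u) (C.decode u) w ∂C.law ≤
      N * e₀ := by
    rw [hNe]
    exact (sum_embedding_condError_le (by omega) C).trans
      (mul_le_mul_of_nonneg_left hCε (by positivity))
  have hNnn : 0 ≤ N := Nat.cast_nonneg _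
  have hnats : (1 - e₀) * Real.log (M.choose Ka) - Real.binEntropy e₀ ≤
      L * (n * Real.log (1 + Ka * P) -
        ∫ X : CArr n Ka, Real.log (gram (of X)).det.re ∂(iidArr n Ka ν)) := by
    -- At level zero the test value `e` would not be positive. The inequality is instead obtained at
    -- every small positive level, and both sides are compared in the limit by continuity of the
    -- entropy.
    rcases he₀0.eq_or_lt with h0 | h0
    · have hcont : Continuous fun e : ℝ =>
          (1 - e) * Real.log (M.choose Ka) - Real.binEntropy e := by fun_prop
      refine le_of_tendsto ((hcont.tendsto e₀).mono_left
        (nhdsWithin_le_nhds (s := Set.Ioi e₀))) ?_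
      have hpos : e₀ < (M.choose Ka : ℝ) / (1 + (M.choose Ka : ℝ)) := by
        rw [← h0]; positivity
      filter_upwards [Ioc_mem_nhdsGT hpos] with e he
      exact fano_nats hKa hν hP C hC (he₀0.trans_lt he.1) he.2
        (herr.trans (mul_le_mul_of_nonneg_left he.1.le hNnn))
    · exact fano_nats hKa hν hP C hC h0 he₀1 herr
  have hlog2 : 0 < Real.log 2 := Real.log_pos (by norm_num)
  have hint : ∫ X : CArr n Ka, logDet X ∂(iidArr n Ka ν) =
      (∫ X : CArr n Ka, Real.log (gram (of X)).det.re ∂(iidArr n Ka ν)) / Real.log 2 := by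
    simp_rw [logDet_eq]; rw [integral_div]
  have := div_le_div_of_nonneg_right hnats hlog2.le
  rw [FanoCondition, ← he₀, hint, h₂]
  refine (le_of_eq ?_).trans (this.trans (le_of_eq ?_))
  · rw [Real.binEntropy, Real.log_inv, Real.log_inv]
    simp only [Real.logb]
    ring
  · simp only [Real.logb]
    ring

end URA

end

theorem theorem11 (n M Ka L : ℕ) (hM : 2 ≤ M) (hKa : Ka ≤ M) (ε : ℝ) (hε₀ : 0 ≤ ε)
    (hε : ε ≤ (M.choose Ka : ℝ) / (1 + (M.choose Ka : ℝ)) * URA.distinctRatio M Ka)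
    (ν : ℝ → MeasureTheory.Measure ℂ) (hν : ∀ P : ℝ, 0 < P → URA.IsEntryLaw (ν P) P) :
    (∀ P : ℝ, 0 < P → ∀ C : URA.EnsembleCode n M Ka L,
      C.HasIIDEntries (ν P) → C.jointError ≤ ε →
        MeasureTheory.Integrable (fun X => URA.logDet X) (URA.iidArr n Ka (ν P)) ∧
        URA.FanoCondition n M Ka L ε P (ν P)) ∧
    URA.converseBound n M Ka L ε ν ≤ URA.minEnergyPerBit n M Ka L ε ν ∧
    URA.converseBound n M Ka L ε ν ≤ URA.minEnergyPerBitMaxPower n M Ka L ε ν := by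
  have key : ∀ P : ℝ, 0 < P → ∀ C : URA.EnsembleCode n M Ka L,
      C.HasIIDEntries (ν P) → C.jointError ≤ ε → URA.FanoCondition n M Ka L ε P (ν P) :=
    fun P hP C hC hCε => URA.fanoCondition hM hKa (hν P hP) hP hε₀ hε C hC hCε
  refine ⟨fun P hP C hC hCε => ⟨URA.integrable_logDet (hν P hP), key P hP C hC hCε⟩, ?_, ?_⟩
  -- Every achievable power satisfies the Fano condition, so the infimum on the left runs over a
  -- larger set.
  · refine sInf_le_sInf ?_
    rintro e ⟨P, hP, he, C, hC, hCε⟩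
    exact ⟨P, hP, he, key P hP C hC hCε⟩
  -- The power constraint only shrinks the set of admissible codes, so it is discarded.
  · refine sInf_le_sInf ?_
    rintro e ⟨P, hP, he, C, -, hC, hCε⟩
    exact ⟨P, hP, he, key P hP C hC hCε⟩
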